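/- Let $\mathbb R_+=(0,\infty)$, let $\zeta\in(-\tfrac12,\infty)$, $\alpha\in(0,\min\{2,2\zeta+1\})$ and $\eta\in[0,(2\zeta+1-\alpha)/2]$ (the critical value $\eta=(2\zeta+1-\alpha)/2$ is included), and put $h(r):=r^{-\eta}$ for $r>0$. Let $\nu_\zeta$ be the Lévy kernel of the $\tfrac\alpha2$-subordinated Bessel semigroup on $L^2(\mathbb R_+,r^{2\zeta}dr)$, that is, for $r,s>0$ with $r\neq s$, $$\nu_\zeta(r,s)=2^{1+\alpha}\,\frac{\Gamma(\frac\alpha2+1)\sin(\frac{\pi\alpha}2)}{\pi}\,\Gamma\Big(\zeta+\frac\alpha2+\frac12\Big)\,(r^2+s^2)^{-(\zeta+\frac\alpha2+\frac12)}\;{}_2\tilde F_1\Big(\frac{\zeta+\alpha/2+1/2}{2},\frac{\zeta+\alpha/2+3/2}{2};\zeta+\frac12;\frac{4(rs)^2}{(r^2+s^2)^2}\Big),$$ where ${}_2\tilde F_1(a,b;c;z)={}_2F_1(a,b;c;z)/\Gamma(c)$ is the regularized hypergeometric function. For $u\in L^2(\mathbb R_+,r^{2\zeta}dr)$ (complex-valued)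 set $$\mathcal I_{\zeta,\eta}[u]:=\frac12\int_0^\infty dr\,r^{2\zeta}\int_0^\infty ds\,s^{2\zeta}\,\nu_\zeta(r,s)\left|\frac{u(r)}{h(r)}-\frac{u(s)}{h(s)}\right|^2h(r)h(s)\in[0,\infty],$$ $$\mathcal D(\mathcal I_{\zeta,\eta}):=\{u\in L^2(\mathbb R_+,r^{2\zeta}dr):\ \mathcal I_{\zeta,\eta}[u]<\infty\}.$$ Then $C_c^\infty(\mathbb R_+)$, the space of smooth functions with compact support in the open half-line $(0,\infty)$, is contained in $\mathcal D(\mathcal I_{\zeta,\eta})$ and is dense in it with respect to the form norm $\sqrt{\mathcal I_{\zeta,\eta}[\,\cdot\,]}+\|\cdot\|_{L^2(\mathbb R_+,r^{2\zeta}dr)}$: for every $u\in\mathcal D(\mathcal I_{\zeta,\eta})$ and every $\varepsilon>0$ there is $\varphi\in C_c^\infty(\mathbb R_+)$ with $$\sqrt{\mathcal I_{\zeta,\eta}[u-\varphi]}+\|u-\varphi\|_{L^2(\mathbb R_+,r^{2\zeta}dr)}<\varepsilon .$$ -/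

import Mathlib

open MeasureTheory Set

noncomputable section

namespace HardyForm

/-- The reference measure `r ^ (2ζ) dr` on `ℝ₊ = (0, ∞)`, as a measure on `ℝ` carried by `ℝ₊`. -/
def refMeasure (ζ : ℝ) : Measure ℝ :=
  (volume.restrict (Ioi (0 : ℝ))).withDensity (fun r => ENNReal.ofReal (r ^ (2 * ζ)))

/-- The regularized hypergeometric function `₂F₁(a, b; c; z) / Γ(c)`
(used for `c > 0` and `0 ≤ z < 1`). -/
def regHypergeometric (a b c z : ℝ) : ℝ :=
  ordinaryHypergeometric a b c z / Real.Gamma c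

/-- The Lévy kernel `ν_ζ(r, s)`, `r ≠ s`, of the `α/2`-subordinated Bessel heat kernel with
reference measure `r ^ (2ζ) dr`. -/
def levyKernel (ζ α r s : ℝ) : ℝ :=
  2 ^ (1 + α) * (Real.Gamma (α / 2 + 1) * Real.sin (Real.pi * α / 2) / Real.pi)
    * Real.Gamma (ζ + α / 2 + 1 / 2)
    * (r ^ 2 + s ^ 2) ^ (-(ζ + α / 2 + 1 / 2))
    * regHypergeometric ((ζ + α / 2 + 1 / 2) / 2) ((ζ + α / 2 + 3 / 2) / 2) (ζ + 1 / 2)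
        (4 * (r * s) ^ 2 / (r ^ 2 + s ^ 2) ^ 2)

/-- The generalized ground state `h(r) = r ^ (-η)`. -/
def groundState (η r : ℝ) : ℝ := r ^ (-η)

/-- The ground-state form
`I_{ζ,η}[u] = 1/2 ∫₀^∞ dr r^{2ζ} ∫₀^∞ ds s^{2ζ} ν_ζ(r,s) |u(r)/h(r) - u(s)/h(s)|² h(r) h(s)`,
with values in `[0, ∞]`. -/
def groundForm (ζ α η : ℝ) (u : ℝ → ℂ) : ENNReal :=
  (1 / 2) * ∫⁻ r in Ioi (0 : ℝ), ∫⁻ s in Ioi (0 : ℝ),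
    ENNReal.ofReal (r ^ (2 * ζ) * s ^ (2 * ζ) * levyKernel ζ α r s
      * ‖u r / (groundState η r : ℂ) - u s / (groundState η s : ℂ)‖ ^ 2
      * groundState η r * groundState η s)

/-- The maximal domain `D(I_{ζ,η}) = {u ∈ L²(ℝ₊, r^{2ζ} dr) : I_{ζ,η}[u] < ∞}`
(its elements are represented by functions on `ℝ`, whose values off `ℝ₊` are irrelevant). -/
def formDomain (ζ α η : ℝ) : Set (ℝ → ℂ) :=
  {u | MemLp u 2 (refMeasure ζ) ∧ groundForm ζ α η u < ⊤}

/-- The form norm `√(I_{ζ,η}[u]) + ‖u‖_{L²(ℝ₊, r^{2ζ} dr)}`, with values in `[0, ∞]`. -/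
def formNorm (ζ α η : ℝ) (u : ℝ → ℂ) : ENNReal :=
  groundForm ζ α η u ^ (1 / 2 : ℝ) + eLpNorm u 2 (refMeasure ζ)

/-- `C_c^∞(ℝ₊)`: smooth functions with compact support contained in `(0, ∞)`
(extended by zero to `ℝ`). -/
def testFunctions : Set (ℝ → ℂ) :=
  {φ | ContDiff ℝ ((⊤ : ℕ∞) : WithTop ℕ∞) φ ∧ HasCompactSupport φ ∧ tsupport φ ⊆ Ioi (0 : ℝ)}

end HardyForm

end

noncomputable section

namespace HardyForm

open Filter Topology

/-! Put r = e^x, s = e^y, w = u/h. By homogeneity of the kernel the form becomes ½∬ e^{β(x+y)}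
k(x-y) |w(x)-w(y)|² dx dy, and the squared L² norm becomes ∫ e^{2γx} |w|² dx, with β = (2ζ+1-α)/2 -
η ≥ 0 and γ = ζ+1/2-η = β + α/2 (`groundForm_eq`, `eLpNorm_refMeasure_eq`). Test functions on the
half-line correspond to C_c^∞(ℝ). The only quantitative fact needed about the even profile k is ∫
k(t) e^{β|t|} t² dt < ∞ (`profileMoment_levyProfile_lt_top`), which follows from a non-sharp bound
on the hypergeometric function near z = 1.

Three approximations then suffice (`exists_smooth_logNorm_lt`). Truncating the values of w converges
by dominated convergence. For bounded w, a Lipschitz cutoff at scale n in the variable x costs a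
commutator term of squared size at most a constant times n^{-2} ∫_{|x| ≲ n} e^{2βx} |w|². For x ≥ 0
this is controlled by the L² norm because β ≤ γ; for x ≤ 0 the integrand is bounded, which gives
O(1/n). The value β = 0, that is the critical η, is thus covered.

Finally, translating w (a dilation in r) translates the weighted difference diagonally in ℝ², up to
a factor e^{βa}. As that function lies in L²(ℝ²), continuity of translations and Minkowski's
inequality make mollification converge, with no further kernel estimate. -/

/-! ### L² tools: domination, translation, averaging. -/

theorem eLpNorm_two_sq {X E : Type*} [MeasurableSpace X] [NormedAddCommGroup E] (μ : Measure X)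
    (f : X → E) : eLpNorm f 2 μ ^ 2 = ∫⁻ x, ‖f x‖ₑ ^ 2 ∂μ := by
  have := eLpNorm_nnreal_pow_eq_lintegral (μ := μ) (f := f) (p := 2) (by norm_num)
  simpa using this

theorem tendsto_eLpNorm_two_of_dominated {X E : Type*} [MeasurableSpace X]
    [NormedAddCommGroup E] {μ : Measure X} {F : ℕ → X → E} {G : X → ℂ} (C : ℝ) (hF : ∀ n, AEStronglyMeasurable (F n) μ)
    (hG : MemLp G 2 μ) (hle : ∀ n x, ‖F n x‖ ≤ C * ‖G x‖)
    (hlim : ∀ x, Tendsto (fun n => F n x) atTop (𝓝 0)) :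
    Tendsto (fun n => eLpNorm (F n) 2 μ) atTop (𝓝 0) := by
  have key : Tendsto (fun n => ∫⁻ x, ‖F n x‖ₑ ^ 2 ∂μ) atTop (𝓝 (∫⁻ _, 0 ∂μ)) := by
    refine tendsto_lintegral_of_dominated_convergence' (fun x => ‖(C : ℝ) • G x‖ₑ ^ 2)
      (fun n => (hF n).enorm.pow_const 2) (fun n => ae_of_all _ fun x => ?_) ?_
      (ae_of_all _ fun x => ?_)
    · refine pow_le_pow_left' ?_ 2
      rw [enorm_le_iff_norm_le, norm_smul, Real.norm_eq_abs]
      exact (hle n x).trans (by gcongr; exact le_abs_self C)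
    · rw [← eLpNorm_two_sq]
      exact (ENNReal.pow_lt_top (hG.const_smul C).2).ne
    · have h := ENNReal.Tendsto.pow (n := 2) (hlim x).enorm
      simpa using h
  rw [lintegral_zero] at key
  have h2 : Tendsto (fun n => (∫⁻ x, ‖F n x‖ₑ ^ 2 ∂μ) ^ (1 / 2 : ℝ)) atTop
      (𝓝 (0 ^ (1 / 2 : ℝ))) := (ENNReal.continuous_rpow_const.tendsto _).comp key
  rw [ENNReal.zero_rpow_of_pos (by norm_num)] at h2
  refine h2.congr fun n => ?_
  rw [← eLpNorm_two_sq, ← ENNReal.rpow_natCast, ← ENNReal.rpow_mul]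
  norm_num

/-- Strong continuity of the translation action on L², expressed on representatives. -/
theorem tendsto_eLpNorm_translate_sub {X : Type*} [NormedAddCommGroup X] [NormedSpace ℝ X]
    [FiniteDimensional ℝ X] [MeasurableSpace X] [BorelSpace X] {μ : Measure X}
    [μ.IsAddHaarMeasure] {f : X → ℂ} (hf : MemLp f 2 μ) :
    Tendsto (fun a : X => eLpNorm (fun x => f (a + x) - f x) 2 μ) (𝓝 0) (𝓝 0) := by
  have : Fact ((2 : ENNReal) ≠ ⊤) := ⟨by norm_num⟩
  have hc : Continuous (fun a : X => DomAddAct.mk a +ᵥ hf.toLp f) := by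
    have : Continuous (fun a : X => (DomAddAct.mk a : Xᵈᵃᵃ)) := DomAddAct.continuous_mk
    exact this.vadd continuous_const
  have h0 := (hc.tendsto 0)
  rw [tendsto_iff_edist_tendsto_0] at h0
  refine h0.congr fun a => ?_
  have h1 : (DomAddAct.mk a +ᵥ hf.toLp f : Lp ℂ 2 μ) =ᵐ[μ] fun x => f (a + x) := by
    refine (DomAddAct.vadd_Lp_ae_eq _ _).trans ?_
    exact (measurePreserving_add_left μ a).quasiMeasurePreserving.ae_eq_comp hf.coeFn_toLp
  have h2 : (DomAddAct.mk (0 : X) +ᵥ hf.toLp f : Lp ℂ 2 μ) =ᵐ[μ] f := by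
    have : (DomAddAct.mk (0 : X) +ᵥ hf.toLp f : Lp ℂ 2 μ) = hf.toLp f := by
      rw [DomAddAct.mk_zero, zero_vadd]
    rw [this]; exact hf.coeFn_toLp
  rw [Lp.edist_def]
  exact eLpNorm_congr_ae (h1.sub h2)

/-- Minkowski's integral inequality: ρ da is a probability measure, so the L¹ norm in a is at most
the L² norm, and Tonelli exchanges the integrals. Only those a with ρ a ≠ 0 matter, so δ may be a
local modulus. -/
theorem eLpNorm_two_average_le {X : Type*} [MeasurableSpace X] {μ : Measure X} [SFinite μ]
    {ρ : ℝ → ℝ} (hρ : Continuous ρ) (hρ0 : ∀ a, 0 ≤ ρ a) (hρi : Integrable ρ) (hρ1 : ∫ a, ρ a = 1)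
    {F : ℝ → X → ℂ} (hF : Measurable (fun p : ℝ × X => F p.1 p.2)) {δ : ENNReal}
    (hδ : ∀ a, ρ a ≠ 0 → eLpNorm (F a) 2 μ ≤ δ) :
    eLpNorm (fun x => ∫ a, ρ a • F a x) 2 μ ≤ δ := by
  set π : Measure ℝ := volume.withDensity (fun a => ENNReal.ofReal (ρ a)) with hπ
  have hm : Measurable (fun a => ENNReal.ofReal (ρ a)) := hρ.measurable.ennreal_ofReal
  have hπ1 : ∫⁻ a, ENNReal.ofReal (ρ a) = 1 := by
    rw [← ofReal_integral_eq_lintegral_ofReal hρi (ae_of_all _ hρ0), hρ1, ENNReal.ofReal_one]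
  have : IsProbabilityMeasure π := ⟨by simp [hπ, hπ1]⟩
  have hFm : Measurable (fun p : X × ℝ => ‖F p.2 p.1‖ₑ ^ 2) :=
    ((hF.comp measurable_swap).enorm).pow_const 2
  have hpt : ∀ x, ‖∫ a, ρ a • F a x‖ₑ ^ 2 ≤ ∫⁻ a, ‖F a x‖ₑ ^ 2 ∂π := by
    intro x
    have hFx : Measurable (fun a => F a x) := hF.comp (measurable_id.prodMk measurable_const)
    rw [← eLpNorm_two_sq]
    gcongr
    calc ‖∫ a, ρ a • F a x‖ₑ ≤ ∫⁻ a, ‖ρ a • F a x‖ₑ := enorm_integral_le_lintegral_enorm _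
      _ = ∫⁻ a, ENNReal.ofReal (ρ a) * ‖F a x‖ₑ := by
          refine lintegral_congr fun a => ?_
          rw [enorm_smul, Real.enorm_eq_ofReal (hρ0 a)]
      _ = ∫⁻ a, ‖F a x‖ₑ ∂π := by
          rw [hπ, lintegral_withDensity_eq_lintegral_mul _ hm hFx.enorm]; rfl
      _ = eLpNorm (fun a => F a x) 1 π := eLpNorm_one_eq_lintegral_enorm.symm
      _ ≤ eLpNorm (fun a => F a x) 2 π :=
          eLpNorm_le_eLpNorm_of_exponent_le (by norm_num) hFx.aestronglyMeasurable
  have hsq : eLpNorm (fun x => ∫ a, ρ a • F a x) 2 μ ^ 2 ≤ δ ^ 2 := by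
    rw [eLpNorm_two_sq]
    calc ∫⁻ x, ‖∫ a, ρ a • F a x‖ₑ ^ 2 ∂μ ≤ ∫⁻ x, ∫⁻ a, ‖F a x‖ₑ ^ 2 ∂π ∂μ := lintegral_mono hpt
      _ = ∫⁻ a, ∫⁻ x, ‖F a x‖ₑ ^ 2 ∂μ ∂π := lintegral_lintegral_swap hFm.aemeasurable
      _ = ∫⁻ a, ENNReal.ofReal (ρ a) * ∫⁻ x, ‖F a x‖ₑ ^ 2 ∂μ := by
          rw [hπ, lintegral_withDensity_eq_lintegral_mul _ hm]
          · rfl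
          · exact (hFm.comp measurable_swap).lintegral_prod_right'
      _ ≤ ∫⁻ a, ENNReal.ofReal (ρ a) * δ ^ 2 := by
          refine lintegral_mono fun a => ?_
          by_cases h : ρ a = 0
          · simp [h]
          · simp only [← eLpNorm_two_sq]
            gcongr
            exact hδ a h
      _ = δ ^ 2 := by rw [lintegral_mul_const _ hm, hπ1, one_mul]
  exact (ENNReal.pow_le_pow_left_iff two_ne_zero).1 hsq

/-! ### The form in logarithmic coordinates. -/

/-- Square root of the weight of the form in logarithmic coordinates. -/
def diffWeight (β : ℝ) (q : ℝ → ℝ) (p : ℝ × ℝ) : ℝ :=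
  Real.exp (β * (p.1 + p.2) / 2) * q (p.1 - p.2)

/-- The weighted difference, whose `L²` norm is the form in logarithmic coordinates. -/
def logDiff (β : ℝ) (q : ℝ → ℝ) (w : ℝ → ℂ) (p : ℝ × ℝ) : ℂ :=
  diffWeight β q p • (w p.1 - w p.2)

/-- The exponentially weighted function, whose `L²` norm is the reference norm. -/
def expMul (γ : ℝ) (w : ℝ → ℂ) (x : ℝ) : ℂ := Real.exp (γ * x) • w x

/-- The weighted second moment of the squared profile. -/
def profileMoment (β : ℝ) (q : ℝ → ℝ) : ENNReal :=
  ∫⁻ t, ENNReal.ofReal (q t ^ 2 * Real.exp (β * |t|) * t ^ 2)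

theorem measurable_diffWeight {β : ℝ} {q : ℝ → ℝ} (hq : Measurable q) :
    Measurable (diffWeight β q) := by
  unfold diffWeight
  fun_prop

theorem diffWeight_nonneg {β : ℝ} {q : ℝ → ℝ} (hq0 : ∀ t, 0 ≤ q t) (p : ℝ × ℝ) :
    0 ≤ diffWeight β q p := mul_nonneg (Real.exp_pos _).le (hq0 _)

theorem diffWeight_swap {β : ℝ} {q : ℝ → ℝ} (hqe : ∀ t, q (-t) = q t) (p : ℝ × ℝ) :
    diffWeight β q p.swap = diffWeight β q p := by
  unfold diffWeight
  rw [← hqe (p.1 - p.2)]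
  simp [add_comm]

theorem measurable_logDiff {β : ℝ} {q : ℝ → ℝ} (hq : Measurable q) {w : ℝ → ℂ}
    (hw : Measurable w) : Measurable (logDiff β q w) := by
  have := measurable_diffWeight (β := β) hq
  unfold logDiff
  fun_prop

theorem measurable_expMul {γ : ℝ} {w : ℝ → ℂ} (hw : Measurable w) : Measurable (expMul γ w) := by
  unfold expMul
  fun_prop

theorem logDiff_sub (β : ℝ) (q : ℝ → ℝ) (w v : ℝ → ℂ) :
    logDiff β q (w - v) = logDiff β q w - logDiff β q v := by
  ext p
  simp only [logDiff, Pi.sub_apply, Complex.real_smul]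
  ring

theorem expMul_sub (γ : ℝ) (w v : ℝ → ℂ) : expMul γ (w - v) = expMul γ w - expMul γ v := by
  ext p
  simp only [expMul, Pi.sub_apply, Complex.real_smul]
  ring

theorem norm_logDiff {β : ℝ} {q : ℝ → ℝ} (hq0 : ∀ t, 0 ≤ q t) (w : ℝ → ℂ) (p : ℝ × ℝ) :
    ‖logDiff β q w p‖ = diffWeight β q p * ‖w p.1 - w p.2‖ := by
  rw [logDiff, norm_smul, Real.norm_eq_abs, abs_of_nonneg (diffWeight_nonneg hq0 p)]

theorem norm_expMul (γ : ℝ) (w : ℝ → ℂ) (x : ℝ) :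
    ‖expMul γ w x‖ = Real.exp (γ * x) * ‖w x‖ := by
  rw [expMul, norm_smul, Real.norm_eq_abs, abs_of_pos (Real.exp_pos _)]

/-- The weight decouples through e^{β(x+y)} ≤ e^{2βx} e^{β|x-y|}; integrating in y then leaves the
profile moment, where the factor |x-y|² compensates the singularity on the diagonal. -/
theorem eLpNorm_diffWeight_fst_le {β : ℝ} (hβ : 0 ≤ β) {q : ℝ → ℝ} (hq : Measurable q)
    {b : ℝ → ℝ} (hb : Measurable b) :
    eLpNorm (fun p : ℝ × ℝ => diffWeight β q p * |p.1 - p.2| * b p.1) 2 volume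
      ≤ profileMoment β q ^ (1 / 2 : ℝ) * eLpNorm (fun x => Real.exp (β * x) * b x) 2 volume := by
  rw [← ENNReal.pow_le_pow_left_iff two_ne_zero, mul_pow, eLpNorm_two_sq, eLpNorm_two_sq,
    ← ENNReal.rpow_natCast (_ ^ (1 / 2 : ℝ)), ← ENNReal.rpow_mul]
  norm_num only [Nat.cast_ofNat, ENNReal.rpow_one]
  have hm := measurable_diffWeight (β := β) hq
  rw [Measure.volume_eq_prod, lintegral_prod _ (by fun_prop)]
  have hm2 : Measurable fun t => ENNReal.ofReal (q t ^ 2 * Real.exp (β * |t|) * t ^ 2) := by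
    fun_prop
  calc ∫⁻ x, ∫⁻ y, ‖diffWeight β q (x, y) * |x - y| * b x‖ₑ ^ 2
      ≤ ∫⁻ x, ∫⁻ y, ‖Real.exp (β * x) * b x‖ₑ ^ 2 *
          ENNReal.ofReal (q (x - y) ^ 2 * Real.exp (β * |x - y|) * (x - y) ^ 2) := by
        refine lintegral_mono fun x => lintegral_mono fun y => ?_
        rw [← ofReal_norm, ← ofReal_norm, ← ENNReal.ofReal_pow (norm_nonneg _),
          ← ENNReal.ofReal_pow (norm_nonneg _), ← ENNReal.ofReal_mul (by positivity)]
        refine ENNReal.ofReal_le_ofReal ?_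
        simp only [Real.norm_eq_abs, sq_abs, diffWeight]
        have h1 : Real.exp (β * (x + y) / 2) ^ 2 ≤ Real.exp (β * x) ^ 2 * Real.exp (β * |x - y|) := by
          rw [← Real.exp_nat_mul, ← Real.exp_nat_mul, ← Real.exp_add]
          refine Real.exp_le_exp.2 ?_
          have := mul_le_mul_of_nonneg_left (neg_abs_le (x - y)) hβ
          push_cast
          linarith
        calc (Real.exp (β * (x + y) / 2) * q (x - y) * |x - y| * b x) ^ 2
            = Real.exp (β * (x + y) / 2) ^ 2 * (q (x - y) * (x - y) * b x) ^ 2 := by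
              rw [mul_pow, mul_pow, mul_pow, sq_abs]; ring
          _ ≤ Real.exp (β * x) ^ 2 * Real.exp (β * |x - y|) * (q (x - y) * (x - y) * b x) ^ 2 := by
              gcongr
          _ = _ := by ring
    _ = ∫⁻ x, ‖Real.exp (β * x) * b x‖ₑ ^ 2 * profileMoment β q := by
        refine lintegral_congr fun x => ?_
        rw [lintegral_const_mul _ (by fun_prop), profileMoment,
          lintegral_sub_left_eq_self
            (fun t => ENNReal.ofReal (q t ^ 2 * Real.exp (β * |t|) * t ^ 2)) x]
    _ = _ := by
        rw [lintegral_mul_const _ (by fun_prop), mul_comm]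

theorem eLpNorm_diffWeight_snd {β : ℝ} {q : ℝ → ℝ} (hq : Measurable q)
    (hqe : ∀ t, q (-t) = q t) {b : ℝ → ℝ} (hb : Measurable b) :
    eLpNorm (fun p : ℝ × ℝ => diffWeight β q p * |p.1 - p.2| * b p.2) 2 volume
      = eLpNorm (fun p : ℝ × ℝ => diffWeight β q p * |p.1 - p.2| * b p.1) 2 volume := by
  have hm := measurable_diffWeight (β := β) hq
  rw [Measure.volume_eq_prod]
  rw [← eLpNorm_comp_measurePreserving (g := fun p : ℝ × ℝ => diffWeight β q p * |p.1 - p.2| * b p.1)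
    (Measurable.aestronglyMeasurable (by fun_prop)) (Measure.measurePreserving_swap (α := ℝ) (β := ℝ)
      (μ := volume) (ν := volume))]
  congr 1
  ext p
  simp only [Function.comp, diffWeight_swap hqe, Prod.fst_swap, Prod.snd_swap, abs_sub_comm p.1 p.2]

theorem eLpNorm_le_of_norm_le_diffWeight {β : ℝ} (hβ : 0 ≤ β) {q : ℝ → ℝ} (hq : Measurable q)
    (hqe : ∀ t, q (-t) = q t) {b : ℝ → ℝ} (hb : Measurable b) {F : ℝ × ℝ → ℂ}
    (hF : ∀ p, ‖F p‖ ≤ diffWeight β q p * |p.1 - p.2| * (b p.1 + b p.2)) :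
    eLpNorm F 2 volume ≤ 2 * (profileMoment β q ^ (1 / 2 : ℝ) *
      eLpNorm (fun x => Real.exp (β * x) * b x) 2 volume) := by
  have hm := measurable_diffWeight (β := β) hq
  refine (eLpNorm_mono_real hF).trans ?_
  have : (fun p : ℝ × ℝ => diffWeight β q p * |p.1 - p.2| * (b p.1 + b p.2))
      = (fun p => diffWeight β q p * |p.1 - p.2| * b p.1)
        + (fun p => diffWeight β q p * |p.1 - p.2| * b p.2) := by
    ext p; simp only [Pi.add_apply]; ring
  rw [this, two_mul]
  refine (eLpNorm_add_le (Measurable.aestronglyMeasurable (by fun_prop))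
    (Measurable.aestronglyMeasurable (by fun_prop)) one_le_two).trans ?_
  rw [eLpNorm_diffWeight_snd hq hqe hb]
  exact add_le_add (eLpNorm_diffWeight_fst_le hβ hq hb) (eLpNorm_diffWeight_fst_le hβ hq hb)

/-- A difference φ(x)-φ(y) vanishes unless x or y lies in the support, so the Lipschitz bound may be
charged to a multiple of the indicator of the support at x or at y. -/
theorem memLp_logDiff_of_lipschitz {β : ℝ} (hβ : 0 ≤ β) {q : ℝ → ℝ} (hq : Measurable q)
    (hq0 : ∀ t, 0 ≤ q t) (hqe : ∀ t, q (-t) = q t) (hmom : profileMoment β q < ⊤) {φ : ℝ → ℂ}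
    {C : NNReal} (hφ : LipschitzWith C φ) (hφc : HasCompactSupport φ) :
    MemLp (logDiff β q φ) 2 volume := by
  refine ⟨(measurable_logDiff hq hφ.continuous.measurable).aestronglyMeasurable, ?_⟩
  have hK : IsCompact (tsupport φ) := hφc
  set b : ℝ → ℝ := (tsupport φ).indicator fun _ => (C : ℝ) with hbdef
  have hb0 : ∀ x, 0 ≤ b x := fun x => indicator_nonneg (fun _ _ => C.2) x
  have hbx : ∀ x, x ∈ tsupport φ → b x = C := fun x hx => by simp [hbdef, hx]
  have hb : Measurable b := measurable_const.indicator hK.measurableSet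
  refine (eLpNorm_le_of_norm_le_diffWeight hβ hq hqe hb (fun p => ?_)).trans_lt ?_
  · rw [norm_logDiff hq0, mul_assoc]
    refine mul_le_mul_of_nonneg_left ?_ (diffWeight_nonneg hq0 p)
    have hl := hφ.dist_le_mul p.1 p.2
    rw [dist_eq_norm, Real.dist_eq] at hl
    by_cases h1 : p.1 ∈ tsupport φ
    · rw [hbx _ h1]
      nlinarith [hb0 p.2, abs_nonneg (p.1 - p.2)]
    by_cases h2 : p.2 ∈ tsupport φ
    · rw [hbx _ h2]
      nlinarith [hb0 p.1, abs_nonneg (p.1 - p.2)]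
    · rw [image_eq_zero_of_notMem_tsupport h1, image_eq_zero_of_notMem_tsupport h2, sub_zero,
        norm_zero]
      have := hb0 p.1; have := hb0 p.2
      positivity
  · refine ENNReal.mul_lt_top (by norm_num) (ENNReal.mul_lt_top
      (ENNReal.rpow_lt_top_of_nonneg (by norm_num) hmom.ne) ?_)
    have : (fun x => Real.exp (β * x) * b x)
        = (tsupport φ).indicator fun x => Real.exp (β * x) * C := by
      ext x
      by_cases h : x ∈ tsupport φ <;> simp [hbdef, h]
    rw [this]
    have hc : ContinuousOn (fun x : ℝ => Real.exp (β * x) * C) (tsupport φ) := by fun_prop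
    rw [eLpNorm_indicator_eq_eLpNorm_restrict hK.measurableSet]
    obtain ⟨B, hB⟩ := hK.exists_bound_of_continuousOn hc
    have : IsFiniteMeasure (volume.restrict (tsupport φ)) :=
      isFiniteMeasure_restrict.2 hK.measure_lt_top.ne
    exact (MemLp.of_bound (p := 2) (hc.aestronglyMeasurable hK.measurableSet) B
      (ae_restrict_of_forall_mem hK.measurableSet hB)).2

/-! ### Truncation of the values. -/

/-- Clamping of the real and imaginary parts to `[-n, n]`. -/
def clampC (n : ℕ) (z : ℂ) : ℂ :=
  ⟨max (-(n : ℝ)) (min n z.re), max (-(n : ℝ)) (min n z.im)⟩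

theorem abs_clamp_sub_clamp_le (n x y : ℝ) :
    |max (-n) (min n x) - max (-n) (min n y)| ≤ |x - y| := by
  refine (abs_max_sub_max_le_max _ _ _ _).trans ?_
  rw [sub_self, abs_zero, max_eq_right (abs_nonneg _)]
  refine (abs_min_sub_min_le_max _ _ _ _).trans ?_
  rw [sub_self, abs_zero, max_eq_right (abs_nonneg _)]

theorem norm_clampC_sub_le (n : ℕ) (z z' : ℂ) : ‖clampC n z - clampC n z'‖ ≤ 2 * ‖z - z'‖ := by
  refine (Complex.norm_le_abs_re_add_abs_im _).trans ?_
  have h1 := abs_clamp_sub_clamp_le n z.re z'.re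
  have h2 := abs_clamp_sub_clamp_le n z.im z'.im
  have h3 := Complex.abs_re_le_norm (z - z')
  have h4 := Complex.abs_im_le_norm (z - z')
  simp only [Complex.sub_re, Complex.sub_im, clampC] at *
  linarith

theorem clampC_zero (n : ℕ) : clampC n 0 = 0 := by
  apply Complex.ext <;> simp [clampC]

theorem norm_clampC_le (n : ℕ) (z : ℂ) : ‖clampC n z‖ ≤ 2 * n := by
  refine (Complex.norm_le_abs_re_add_abs_im _).trans ?_
  have hn : (0 : ℝ) ≤ n := n.cast_nonneg
  have : ∀ x : ℝ, |max (-(n : ℝ)) (min n x)| ≤ n := fun x =>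
    abs_le.2 ⟨le_max_left _ _, max_le (by linarith) (min_le_left _ _)⟩
  have h1 := this z.re
  have h2 := this z.im
  simp only [clampC]
  linarith

theorem clampC_eq_self {n : ℕ} {z : ℂ} (h : ‖z‖ ≤ n) : clampC n z = z := by
  have h1 := abs_le.1 ((Complex.abs_re_le_norm z).trans h)
  have h2 := abs_le.1 ((Complex.abs_im_le_norm z).trans h)
  apply Complex.ext <;> simp [clampC, h1, h2]

theorem continuous_clampC (n : ℕ) : Continuous (clampC n) := by
  have : LipschitzWith 2 (clampC n) := LipschitzWith.of_dist_le_mul fun z z' => by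
    simpa [dist_eq_norm] using norm_clampC_sub_le n z z'
  exact this.continuous

/-- The two norms of the form in logarithmic coordinates. -/
def logNorm (β γ : ℝ) (q : ℝ → ℝ) (w : ℝ → ℂ) : ENNReal :=
  eLpNorm (logDiff β q w) 2 volume + eLpNorm (expMul γ w) 2 volume

theorem logNorm_add_sub_le {β γ : ℝ} {q : ℝ → ℝ} (hq : Measurable q) {u v w : ℝ → ℂ}
    (hu : Measurable u) (hv : Measurable v) (hw : Measurable w) :
    logNorm β γ q (u - w) ≤ logNorm β γ q (u - v) + logNorm β γ q (v - w) := by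
  unfold logNorm
  have e : u - w = (u - v) - (w - v) := by abel
  have e' : v - w = -(w - v) := by abel
  have n1 : eLpNorm (logDiff β q (v - w)) 2 volume = eLpNorm (logDiff β q (w - v)) 2 volume := by
    rw [logDiff_sub, logDiff_sub, eLpNorm_sub_comm]
  have n2 : eLpNorm (expMul γ (v - w)) 2 volume = eLpNorm (expMul γ (w - v)) 2 volume := by
    rw [expMul_sub, expMul_sub, eLpNorm_sub_comm]
  rw [e, logDiff_sub, expMul_sub γ (u - v), n1, n2]
  have h1 := eLpNorm_sub_le (p := 2) (μ := volume)
    (measurable_logDiff (β := β) hq (hu.sub hv)).aestronglyMeasurable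
    (measurable_logDiff (β := β) hq (hw.sub hv)).aestronglyMeasurable one_le_two
  have h2 := eLpNorm_sub_le (p := 2) (μ := volume)
    (measurable_expMul (γ := γ) (hu.sub hv)).aestronglyMeasurable
    (measurable_expMul (γ := γ) (hw.sub hv)).aestronglyMeasurable one_le_two
  calc _ ≤ _ := add_le_add h1 h2
    _ = _ := by abel

/-- Clamping is 2-Lipschitz and fixes 0, so every error is dominated by 3 = 1 + 2 times the original
integrand. At a fixed point the clamp is eventually the identity. -/
theorem tendsto_logNorm_sub_clampC {β γ : ℝ} {q : ℝ → ℝ} (hq : Measurable q) (hq0 : ∀ t, 0 ≤ q t)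
    {w : ℝ → ℂ} (hw : Measurable w) (hD : MemLp (logDiff β q w) 2 volume)
    (hS : MemLp (expMul γ w) 2 volume) :
    Tendsto (fun n => logNorm β γ q (w - fun x => clampC n (w x))) atTop (𝓝 0) := by
  have hm : ∀ n, Measurable (w - fun x => clampC n (w x)) := fun n =>
    hw.sub ((continuous_clampC n).measurable.comp hw)
  have hev : ∀ x, ∀ᶠ n : ℕ in atTop, clampC n (w x) = w x := fun x => by
    obtain ⟨N, hN⟩ := exists_nat_ge ‖w x‖
    filter_upwards [eventually_ge_atTop N] with n hn
    exact clampC_eq_self (hN.trans (by exact_mod_cast hn))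
  have h1 := tendsto_eLpNorm_two_of_dominated (μ := volume) 3
    (F := fun n => logDiff β q (w - fun x => clampC n (w x)))
    (fun n => (measurable_logDiff hq (hm n)).aestronglyMeasurable) hD (fun n p => by
      rw [norm_logDiff hq0, norm_logDiff hq0]
      have h : ‖(w p.1 - clampC n (w p.1)) - (w p.2 - clampC n (w p.2))‖
          ≤ 3 * ‖w p.1 - w p.2‖ := by
        rw [sub_sub_sub_comm]
        refine (norm_sub_le _ _).trans ?_
        linarith [norm_clampC_sub_le n (w p.1) (w p.2)]
      have := mul_le_mul_of_nonneg_left h (diffWeight_nonneg (β := β) hq0 p)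
      simp only [Pi.sub_apply]
      linarith) (fun p => by
      refine tendsto_const_nhds.congr' ?_
      filter_upwards [hev p.1, hev p.2] with n h1 h2
      simp [logDiff, h1, h2])
  have h2 := tendsto_eLpNorm_two_of_dominated (μ := volume) 3
    (F := fun n => expMul γ (w - fun x => clampC n (w x)))
    (fun n => (measurable_expMul (hm n)).aestronglyMeasurable) hS (fun n x => by
      rw [norm_expMul, norm_expMul]
      have h : ‖w x - clampC n (w x)‖ ≤ 3 * ‖w x‖ := by
        refine (norm_sub_le _ _).trans ?_
        have := norm_clampC_sub_le n (w x) 0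
        rw [clampC_zero, sub_zero, sub_zero] at this
        linarith
      have := mul_le_mul_of_nonneg_left h (Real.exp_pos (γ * x)).le
      simp only [Pi.sub_apply]
      linarith) (fun x => by
      refine tendsto_const_nhds.congr' ?_
      filter_upwards [hev x] with n h1
      simp [expMul, h1])
  simpa [logNorm] using h1.add h2

/-! ### Cutoff in the logarithmic variable. -/

/-- A Lipschitz cutoff, equal to `1` on `[-(n+1), n+1]` and to `0` off `[-2(n+1), 2(n+1)]`. -/
def cutoff (n : ℕ) (x : ℝ) : ℝ := max 0 (min 1 (2 - |x| / (n + 1)))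

theorem cutoff_nonneg (n : ℕ) (x : ℝ) : 0 ≤ cutoff n x := le_max_left _ _

theorem cutoff_le_one (n : ℕ) (x : ℝ) : cutoff n x ≤ 1 := max_le zero_le_one (min_le_left _ _)

theorem cutoff_eq_zero {n : ℕ} {x : ℝ} (h : 2 * (n + 1 : ℝ) ≤ |x|) : cutoff n x = 0 := by
  have : 2 ≤ |x| / (n + 1 : ℝ) := by rwa [le_div_iff₀ (by positivity)]
  exact max_eq_left ((min_le_right _ _).trans (by linarith))

theorem cutoff_eq_one {n : ℕ} {x : ℝ} (h : |x| ≤ n + 1) : cutoff n x = 1 := by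
  have : |x| / (n + 1 : ℝ) ≤ 1 := by rwa [div_le_one (by positivity)]
  rw [cutoff, min_eq_left (by linarith), max_eq_right zero_le_one]

theorem continuous_cutoff (n : ℕ) : Continuous (cutoff n) := by
  unfold cutoff
  fun_prop

theorem abs_cutoff_sub_le (n : ℕ) (x y : ℝ) :
    |cutoff n x - cutoff n y| ≤ |x - y| / (n + 1) := by
  refine (abs_max_sub_max_le_max _ _ _ _).trans ?_
  rw [sub_self, abs_zero, max_eq_right (abs_nonneg _)]
  refine (abs_min_sub_min_le_max _ _ _ _).trans ?_
  rw [sub_self, abs_zero, max_eq_right (abs_nonneg _), sub_sub_sub_cancel_left, ← sub_div, abs_div,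
    abs_of_pos (show (0 : ℝ) < n + 1 by positivity), abs_sub_comm x y]
  exact div_le_div_of_nonneg_right (abs_abs_sub_abs_le y x) (by positivity)

theorem eventually_cutoff_eq_one (x : ℝ) : ∀ᶠ n : ℕ in atTop, cutoff n x = 1 := by
  obtain ⟨N, hN⟩ := exists_nat_ge |x|
  filter_upwards [eventually_ge_atTop N] with n hn
  have : (N : ℝ) ≤ n := by exact_mod_cast hn
  exact cutoff_eq_one (by linarith)

/-- Discrete product rule. The commutator term carries w only at points with |x| ≤ 2(n+1), since the
difference may be split with either point as base; when both points lie outside, the cutoff vanishes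
and the first term suffices. -/
theorem norm_sub_cutoff_smul_le (n : ℕ) (w : ℝ → ℂ) {b : ℝ → ℝ}
    (hb : b = (Icc (-(2 * (n + 1 : ℝ))) (2 * (n + 1))).indicator fun x => ‖w x‖ / (n + 1))
    (x y : ℝ) :
    ‖(w x - cutoff n x • w x) - (w y - cutoff n y • w y)‖
      ≤ ‖w x - w y‖ * ((1 - cutoff n x) + (1 - cutoff n y)) + |x - y| * (b x + b y) := by
  have hb0 : ∀ x, 0 ≤ b x := fun x => by
    rw [hb]; exact indicator_nonneg (fun _ _ => by positivity) x
  have hin : ∀ x, |x| ≤ 2 * (n + 1 : ℝ) → b x = ‖w x‖ / (n + 1) := fun x hx => by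
    rw [hb, indicator_of_mem (mem_Icc.2 (abs_le.1 hx))]
  have main : ∀ x y, |x| ≤ 2 * (n + 1 : ℝ) →
      ‖(w x - cutoff n x • w x) - (w y - cutoff n y • w y)‖
      ≤ ‖w x - w y‖ * ((1 - cutoff n x) + (1 - cutoff n y)) + |x - y| * (b x + b y) := by
    intro x y hx
    have e : (w x - cutoff n x • w x) - (w y - cutoff n y • w y)
        = (1 - cutoff n y) • (w x - w y) + (cutoff n y - cutoff n x) • w x := by
      simp only [Complex.real_smul]; push_cast; ring
    rw [e]
    refine (norm_add_le _ _).trans ?_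
    rw [norm_smul, norm_smul, Real.norm_eq_abs, Real.norm_eq_abs,
      abs_of_nonneg (sub_nonneg.2 (cutoff_le_one n y)), hin x hx]
    have h1 := abs_cutoff_sub_le n y x
    rw [abs_sub_comm y x] at h1
    have h2 : |cutoff n y - cutoff n x| * ‖w x‖ ≤ |x - y| * (‖w x‖ / (n + 1)) := by
      calc _ ≤ |x - y| / (n + 1) * ‖w x‖ := by gcongr
        _ = _ := by ring
    have h3 := mul_nonneg (norm_nonneg (w x - w y)) (sub_nonneg.2 (cutoff_le_one n x))
    have h4 := mul_nonneg (abs_nonneg (x - y)) (hb0 y)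
    linarith
  by_cases hx : |x| ≤ 2 * (n + 1 : ℝ)
  · exact main x y hx
  by_cases hy : |y| ≤ 2 * (n + 1 : ℝ)
  · have := main y x hy
    rw [norm_sub_rev, norm_sub_rev (w x), abs_sub_comm, add_comm (1 - cutoff n x), add_comm (b x)]
    exact this
  · rw [cutoff_eq_zero (not_le.1 hx).le, cutoff_eq_zero (not_le.1 hy).le]
    simp only [zero_smul, sub_zero]
    have h3 := norm_nonneg (w x - w y)
    have h4 := mul_nonneg (abs_nonneg (x - y)) (add_nonneg (hb0 x) (hb0 y))
    linarith

/-- The first term of the product rule tends to 0 by domination. The commutator term is reduced by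
the moment bound to the norm of e^{βx} w/(n+1) over |x| ≤ 2(n+1); boundedness of w is needed for the
half x ≤ 0, where e^{γx} may be much smaller than e^{βx}. -/
theorem tendsto_logNorm_sub_cutoff {β γ : ℝ} (hβ : 0 ≤ β) (hγ : β ≤ γ) {q : ℝ → ℝ}
    (hq : Measurable q) (hq0 : ∀ t, 0 ≤ q t) (hqe : ∀ t, q (-t) = q t)
    (hmom : profileMoment β q < ⊤)
    {w : ℝ → ℂ} (hw : Measurable w) {M : ℝ} (hM : ∀ x, ‖w x‖ ≤ M)
    (hD : MemLp (logDiff β q w) 2 volume) (hS : MemLp (expMul γ w) 2 volume) :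
    Tendsto (fun n => logNorm β γ q (w - fun x => cutoff n x • w x)) atTop (𝓝 0) := by
  have hM0 : 0 ≤ M := (norm_nonneg _).trans (hM 0)
  have hm : ∀ n, Measurable (w - fun x => cutoff n x • w x) := fun n =>
    hw.sub ((continuous_cutoff n).measurable.smul hw)
  have hc0 : ∀ n x, 0 ≤ 1 - cutoff n x := fun n x => sub_nonneg.2 (cutoff_le_one n x)
  have hc1 : ∀ n x, 1 - cutoff n x ≤ 1 := fun n x => by linarith [cutoff_nonneg n x]
  have hS' := tendsto_eLpNorm_two_of_dominated (μ := volume) 1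
    (F := fun n => expMul γ (w - fun x => cutoff n x • w x))
    (fun n => (measurable_expMul (hm n)).aestronglyMeasurable) hS (fun n x => by
      rw [norm_expMul, norm_expMul, one_mul]
      have e : (w - fun x => cutoff n x • w x) x = (1 - cutoff n x) • w x := by
        simp [sub_smul]
      rw [e, norm_smul, Real.norm_eq_abs, abs_of_nonneg (hc0 n x)]
      have := mul_le_of_le_one_left (norm_nonneg (w x)) (hc1 n x)
      gcongr) (fun x => by
      refine tendsto_const_nhds.congr' ?_
      filter_upwards [eventually_cutoff_eq_one x] with n h1
      simp [expMul, h1])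
  set G : ℕ → ℝ × ℝ → ℝ := fun n p =>
    ‖logDiff β q w p‖ * ((1 - cutoff n p.1) + (1 - cutoff n p.2)) with hGdef
  have hGm : ∀ n, Measurable (G n) := fun n => by
    have h1 := (measurable_logDiff (β := β) hq hw).norm
    have h2 := (continuous_cutoff n).measurable
    exact h1.mul ((measurable_const.sub (h2.comp measurable_fst)).add
      (measurable_const.sub (h2.comp measurable_snd)))
  have hG0 : ∀ n p, 0 ≤ G n p := fun n p =>
    mul_nonneg (norm_nonneg _) (add_nonneg (hc0 n _) (hc0 n _))
  have hG := tendsto_eLpNorm_two_of_dominated (μ := volume) 2 (F := G)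
    (fun n => (hGm n).aestronglyMeasurable) hD (fun n p => by
      rw [Real.norm_eq_abs, abs_of_nonneg (hG0 n p)]
      have := hc1 n p.1; have := hc1 n p.2
      simp only [hGdef]
      rw [mul_comm]
      gcongr
      linarith) (fun p => by
      refine tendsto_const_nhds.congr' ?_
      filter_upwards [eventually_cutoff_eq_one p.1, eventually_cutoff_eq_one p.2] with n h1 h2
      simp [hGdef, h1, h2])
  set I : ℕ → Set ℝ := fun n => Icc (-(2 * (n + 1 : ℝ))) (2 * (n + 1)) with hI
  set b : ℕ → ℝ → ℝ := fun n => (I n).indicator fun x => ‖w x‖ / (n + 1) with hbdef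
  have hbm : ∀ n, Measurable (b n) := fun n => (hw.norm.div_const _).indicator measurableSet_Icc
  have hDle : ∀ n, eLpNorm (logDiff β q (w - fun x => cutoff n x • w x)) 2 volume
      ≤ eLpNorm (G n) 2 volume + 2 * (profileMoment β q ^ (1 / 2 : ℝ) *
        eLpNorm (fun x => Real.exp (β * x) * b n x) 2 volume) := by
    intro n
    have hdm := measurable_diffWeight (β := β) hq
    have hbn := hbm n
    set H : ℝ × ℝ → ℝ := fun p => diffWeight β q p * |p.1 - p.2| * (b n p.1 + b n p.2) with hH
    have hb0 : ∀ x, 0 ≤ b n x := fun x => indicator_nonneg (fun _ _ => by positivity) x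
    have hH0 : ∀ p, 0 ≤ H p := fun p => mul_nonneg (mul_nonneg (diffWeight_nonneg hq0 p)
      (abs_nonneg _)) (add_nonneg (hb0 _) (hb0 _))
    have h1 : eLpNorm (logDiff β q (w - fun x => cutoff n x • w x)) 2 volume
        ≤ eLpNorm (G n + H) 2 volume := by
      refine eLpNorm_mono_real fun p => ?_
      rw [norm_logDiff hq0]
      have h := mul_le_mul_of_nonneg_left
        (norm_sub_cutoff_smul_le n w (b := b n) rfl p.1 p.2) (diffWeight_nonneg (β := β) hq0 p)
      refine h.trans (le_of_eq ?_)
      simp only [Pi.add_apply, hGdef, hH, norm_logDiff hq0]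
      ring
    refine h1.trans ((eLpNorm_add_le (hGm n).aestronglyMeasurable
      (Measurable.aestronglyMeasurable (by fun_prop)) one_le_two).trans ?_)
    gcongr
    have h2 := eLpNorm_le_of_norm_le_diffWeight hβ hq hqe hbn (F := fun p => (H p : ℂ))
      (fun p => by rw [Complex.norm_real, Real.norm_eq_abs, abs_of_nonneg (hH0 p)])
    refine le_trans (le_of_eq ?_) h2
    exact eLpNorm_congr_norm_ae (ae_of_all _ fun p => by rw [Complex.norm_real])
  have hbe : ∀ n, eLpNorm (fun x => Real.exp (β * x) * b n x) 2 volume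
      ≤ ENNReal.ofReal (1 / (n + 1)) * eLpNorm (expMul γ w) 2 volume
        + ENNReal.ofReal (2 * M * (1 / (n + 1 : ℝ)) ^ (1 / 2 : ℝ)) := by
    intro n
    set A : ℝ → ℝ := fun x => (1 / (n + 1 : ℝ)) * ‖expMul γ w x‖ with hA
    set B : ℝ → ℝ := (I n).indicator fun _ => M / (n + 1) with hB
    have hAm : Measurable A := (measurable_expMul hw).norm.const_mul _
    have hBm : Measurable B := measurable_const.indicator measurableSet_Icc
    have h1 : eLpNorm (fun x => Real.exp (β * x) * b n x) 2 volume ≤ eLpNorm (A + B) 2 volume := by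
      refine eLpNorm_mono_real fun x => ?_
      by_cases hx : x ∈ I n
      · simp only [hbdef, hA, hB, Pi.add_apply, indicator_of_mem hx, norm_expMul]
        rw [Real.norm_eq_abs, abs_of_nonneg (by positivity)]
        rw [← mul_div_assoc, one_div, inv_mul_eq_div, ← add_div]
        gcongr
        -- For x ≥ 0, β ≤ γ lets the reference norm absorb the term; for x ≤ 0, e^{βx} ≤ 1 and |w| ≤
        -- M.
        rcases le_total 0 x with h0 | h0
        · have : Real.exp (β * x) ≤ Real.exp (γ * x) :=
            Real.exp_le_exp.2 (mul_le_mul_of_nonneg_right hγ h0)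
          have := mul_le_mul_of_nonneg_right this (norm_nonneg (w x))
          linarith
        · have : Real.exp (β * x) ≤ 1 := Real.exp_le_one_iff.2 (mul_nonpos_of_nonneg_of_nonpos hβ h0)
          have h3 := mul_le_mul_of_nonneg_right this (norm_nonneg (w x))
          have h4 : 0 ≤ Real.exp (γ * x) * ‖w x‖ := by positivity
          have := hM x
          linarith
      · simp only [hbdef, hB, Pi.add_apply, indicator_of_notMem hx, hA]
        simp only [mul_zero, norm_zero, add_zero]
        positivity
    refine h1.trans ((eLpNorm_add_le hAm.aestronglyMeasurable hBm.aestronglyMeasurable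
      one_le_two).trans (add_le_add (le_of_eq ?_) (le_of_eq ?_)))
    · have : A = (1 / (n + 1 : ℝ)) • fun x => ‖expMul γ w x‖ := by ext x; simp [hA]
      rw [this, eLpNorm_const_smul, eLpNorm_norm, Real.enorm_eq_ofReal (by positivity)]
    · rw [hB, eLpNorm_indicator_const measurableSet_Icc two_ne_zero (by norm_num)]
      simp only [Real.volume_Icc, ENNReal.toReal_ofNat]
      rw [Real.enorm_eq_ofReal (by positivity), ENNReal.ofReal_rpow_of_nonneg (by linarith) (by norm_num),
        ← ENNReal.ofReal_mul (by positivity)]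
      congr 1
      have hn : (0 : ℝ) < n + 1 := by positivity
      rw [← Real.sqrt_eq_rpow, ← Real.sqrt_eq_rpow]
      -- The interval has length 4(n+1), so a constant M/(n+1) on it has L² norm 2M (n+1)^{-1/2}.
      have e1 : 2 * ((n : ℝ) + 1) - -(2 * (n + 1)) = (2 * (n + 1)) ^ 2 * (1 / (n + 1)) := by
        field_simp; ring
      rw [e1, Real.sqrt_mul (by positivity), Real.sqrt_sq (by positivity)]
      field_simp
  have hlim : Tendsto (fun n : ℕ => (1 / ((n : ℝ) + 1))) atTop (𝓝 0) :=
    tendsto_one_div_add_atTop_nhds_zero_nat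
  have hbt : Tendsto (fun n => eLpNorm (fun x => Real.exp (β * x) * b n x) 2 volume)
      atTop (𝓝 0) := by
    refine tendsto_of_tendsto_of_tendsto_of_le_of_le tendsto_const_nhds ?_ (fun n => zero_le) hbe
    have t1 : Tendsto (fun n : ℕ => ENNReal.ofReal (1 / ((n : ℝ) + 1)) *
        eLpNorm (expMul γ w) 2 volume) atTop (𝓝 (ENNReal.ofReal 0 * eLpNorm (expMul γ w) 2 volume)) :=
      ENNReal.Tendsto.mul_const (ENNReal.tendsto_ofReal hlim) (Or.inr hS.2.ne)
    have t2 : Tendsto (fun n : ℕ => ENNReal.ofReal (2 * M * (1 / ((n : ℝ) + 1)) ^ (1 / 2 : ℝ)))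
        atTop (𝓝 (ENNReal.ofReal (2 * M * 0 ^ (1 / 2 : ℝ)))) :=
      ENNReal.tendsto_ofReal ((hlim.rpow_const (Or.inr (by norm_num))).const_mul _)
    have := t1.add t2
    rwa [Real.zero_rpow (by norm_num), mul_zero, ENNReal.ofReal_zero, zero_mul, add_zero] at this
  have hDt : Tendsto (fun n => eLpNorm (logDiff β q (w - fun x => cutoff n x • w x)) 2 volume)
      atTop (𝓝 0) := by
    refine tendsto_of_tendsto_of_tendsto_of_le_of_le tendsto_const_nhds ?_ (fun n => zero_le) hDle
    have hK : profileMoment β q ^ (1 / 2 : ℝ) ≠ ⊤ :=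
      (ENNReal.rpow_lt_top_of_nonneg (by norm_num) hmom.ne).ne
    have t := ENNReal.Tendsto.const_mul (a := 2)
      (ENNReal.Tendsto.const_mul hbt (Or.inr hK)) (Or.inr (by norm_num))
    simpa using hG.add t
  simpa [logNorm] using hDt.add hS'

/-! ### Mollification by translation covariance. -/

/-- The general path `T` serves both translation of the line and diagonal translation of the plane;
the exponential factor tends to 1. -/
theorem tendsto_eLpNorm_exp_smul_translate_sub {X : Type*} [NormedAddCommGroup X] [NormedSpace ℝ X]
    [FiniteDimensional ℝ X] [MeasurableSpace X] [BorelSpace X] {μ : Measure X}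
    [μ.IsAddHaarMeasure] {f : X → ℂ} (hf : MemLp f 2 μ) (σ : ℝ) {T : ℝ → X}
    (hT : Continuous T) (hT0 : T 0 = 0) :
    Tendsto (fun a => eLpNorm (fun x => Real.exp (σ * a) • f (T a + x) - f x) 2 μ)
      (𝓝 0) (𝓝 0) := by
  have h1 := (tendsto_eLpNorm_translate_sub hf).comp (hT0 ▸ hT.tendsto 0)
  have hle : ∀ a, eLpNorm (fun x => Real.exp (σ * a) • f (T a + x) - f x) 2 μ
      ≤ ENNReal.ofReal (Real.exp (σ * a)) * eLpNorm (fun x => f (T a + x) - f x) 2 μ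
        + ENNReal.ofReal |Real.exp (σ * a) - 1| * eLpNorm f 2 μ := by
    intro a
    have hfT : MemLp (fun x => f (T a + x)) 2 μ :=
      hf.comp_measurePreserving (measurePreserving_add_left μ (T a))
    have e : (fun x => Real.exp (σ * a) • f (T a + x) - f x)
        = Real.exp (σ * a) • (fun x => f (T a + x) - f x) + (Real.exp (σ * a) - 1) • f := by
      ext x
      simp only [Pi.add_apply, Pi.smul_apply, Complex.real_smul]
      push_cast
      ring
    rw [e]
    refine (eLpNorm_add_le ((hfT.1.sub hf.1).const_smul _) (hf.1.const_smul _) one_le_two).trans ?_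
    rw [eLpNorm_const_smul, eLpNorm_const_smul, Real.enorm_eq_ofReal (Real.exp_pos _).le,
      Real.enorm_eq_ofReal_abs]
    rfl
  refine tendsto_of_tendsto_of_tendsto_of_le_of_le tendsto_const_nhds ?_ (fun n => zero_le) hle
  have c1 : Tendsto (fun a => ENNReal.ofReal (Real.exp (σ * a))) (𝓝 0) (𝓝 (ENNReal.ofReal 1)) := by
    refine ENNReal.tendsto_ofReal ?_
    have : Continuous fun a => Real.exp (σ * a) := by fun_prop
    simpa using this.tendsto 0
  have c2 : Tendsto (fun a => ENNReal.ofReal |Real.exp (σ * a) - 1|) (𝓝 0)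
      (𝓝 (ENNReal.ofReal 0)) := by
    refine ENNReal.tendsto_ofReal ?_
    have : Continuous fun a => |Real.exp (σ * a) - 1| := by fun_prop
    simpa using this.tendsto 0
  have t1 := ENNReal.Tendsto.mul c1 (Or.inr (by norm_num)) h1 (Or.inr (by norm_num))
  have t2 := ENNReal.Tendsto.mul_const (b := eLpNorm f 2 μ) c2 (Or.inr hf.2.ne)
  simpa using t1.add t2

/-- A diagonal shift preserves x-y, hence the profile, and only rescales the exponential weight. -/
theorem logDiff_translate (β : ℝ) (q : ℝ → ℝ) (w : ℝ → ℂ) (a : ℝ) (p : ℝ × ℝ) :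
    logDiff β q (fun x => w (x - a)) p
      = Real.exp (β * a) • logDiff β q w ((-a, -a) + p) := by
  simp only [logDiff, diffWeight, Prod.fst_add, Prod.snd_add, smul_smul]
  rw [← mul_assoc, ← Real.exp_add]
  have e1 : β * a + β * (-a + p.1 + (-a + p.2)) / 2 = β * (p.1 + p.2) / 2 := by ring
  have e2 : -a + p.1 - (-a + p.2) = p.1 - p.2 := by ring
  rw [e1, e2, neg_add_eq_sub, neg_add_eq_sub]

theorem expMul_translate (γ : ℝ) (w : ℝ → ℂ) (a x : ℝ) :
    expMul γ (fun x => w (x - a)) x = Real.exp (γ * a) • expMul γ w (-a + x) := by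
  simp only [expMul, smul_smul, ← Real.exp_add]
  rw [← mul_add, add_neg_cancel_left, neg_add_eq_sub]

/-- Forming the weighted difference commutes with convolution, so both errors are averages of L²
translation errors, small once the bump is supported in a small ball. Boundedness of w makes all the
convolution integrals converge. -/
theorem exists_smooth_logNorm_sub_lt {β γ : ℝ} {q : ℝ → ℝ} (hq : Measurable q)
    {w : ℝ → ℂ} (hw : Measurable w) {M : ℝ} (hM : ∀ x, ‖w x‖ ≤ M) (hwc : HasCompactSupport w)
    (hD : MemLp (logDiff β q w) 2 volume) (hS : MemLp (expMul γ w) 2 volume)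
    {ε : ENNReal} (hε : 0 < ε) :
    ∃ ψ : ℝ → ℂ, ContDiff ℝ ((⊤ : ℕ∞) : WithTop ℕ∞) ψ ∧ HasCompactSupport ψ ∧
      logNorm β γ q (ψ - w) ≤ ε := by
  have hlocal : LocallyIntegrable w volume := by
    refine (locallyIntegrable_const M).mono hw.aestronglyMeasurable (ae_of_all _ fun x => ?_)
    exact (hM x).trans (le_abs_self M)
  have hε2 : 0 < ε / 2 := ENNReal.div_pos hε.ne' (by norm_num)
  have ev1 := (tendsto_eLpNorm_exp_smul_translate_sub hD β (T := fun a => (-a, -a))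
    (by fun_prop) (by simp)).eventually (ge_mem_nhds hε2)
  have ev2 := (tendsto_eLpNorm_exp_smul_translate_sub hS γ (T := fun a => -a)
    (by fun_prop) (by simp)).eventually (ge_mem_nhds hε2)
  obtain ⟨δ, hδ, hball⟩ := Metric.eventually_nhds_iff_ball.1 (ev1.and ev2)
  let φ : ContDiffBump (0 : ℝ) := ⟨δ / 2, δ, by linarith, by linarith⟩
  set ρ : ℝ → ℝ := φ.normed volume with hρ
  have hρc : Continuous ρ := φ.continuous_normed
  have hρi : Integrable ρ := φ.integrable_normed
  have hρ1 : ∫ a, ρ a = 1 := φ.integral_normed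
  have hρ0 : ∀ a, 0 ≤ ρ a := φ.nonneg_normed
  have hsupp : ∀ a, ρ a ≠ 0 → a ∈ Metric.ball (0 : ℝ) δ := fun a ha => by
    have : a ∈ Function.support (φ.normed volume) := ha
    rwa [φ.support_normed_eq] at this
  set ψ : ℝ → ℂ := convolution ρ w (ContinuousLinearMap.lsmul ℝ ℝ) volume with hψ
  have hψx : ∀ x, ψ x = ∫ a, ρ a • w (x - a) := fun x => rfl
  have hint : ∀ x, Integrable fun a => ρ a • w (x - a) := fun x =>
    hρi.smul_bdd M (hw.comp (measurable_const.sub measurable_id)).aestronglyMeasurable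
      (ae_of_all _ fun a => hM _)
  have hdiff : ∀ x, ψ x - w x = ∫ a, ρ a • (w (x - a) - w x) := fun x => by
    simp only [smul_sub]
    rw [integral_sub (hint x) (hρi.smul_const _), integral_smul_const, hρ1, one_smul, hψx]
  have hint' : ∀ x, Integrable fun a => ρ a • (w (x - a) - w x) := fun x => by
    simp only [smul_sub]
    exact (hint x).sub (hρi.smul_const _)
  refine ⟨ψ, φ.hasCompactSupport_normed.contDiff_convolution_left _ φ.contDiff_normed hlocal,
    φ.hasCompactSupport_normed.convolution _ hwc, ?_⟩
  rw [logNorm, ← ENNReal.add_halves ε]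
  refine add_le_add ?_ ?_
  · have e : logDiff β q (ψ - w) = fun p => ∫ a, ρ a •
        (Real.exp (β * a) • logDiff β q w ((-a, -a) + p) - logDiff β q w p) := by
      ext p
      simp only [← logDiff_translate]
      simp only [logDiff, Pi.sub_apply]
      rw [hdiff, hdiff, ← integral_sub (hint' _) (hint' _), ← integral_smul]
      congr 1
      ext a
      simp only [Complex.real_smul]
      ring
    rw [e]
    have hDm := measurable_logDiff (β := β) hq hw
    refine eLpNorm_two_average_le hρc hρ0 hρi hρ1 ?_ fun a ha => (hball a (hsupp a ha)).1
    have h1 : Measurable fun z : ℝ × (ℝ × ℝ) => logDiff β q w ((-z.1, -z.1) + z.2) :=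
      hDm.comp (by fun_prop)
    have h2 : Measurable fun z : ℝ × (ℝ × ℝ) => logDiff β q w z.2 := hDm.comp measurable_snd
    fun_prop
  · have e : expMul γ (ψ - w) = fun x => ∫ a, ρ a •
        (Real.exp (γ * a) • expMul γ w (-a + x) - expMul γ w x) := by
      ext p
      simp only [← expMul_translate]
      simp only [expMul, Pi.sub_apply]
      rw [hdiff, ← integral_smul]
      congr 1
      ext a
      simp only [Complex.real_smul]
      ring
    rw [e]
    have hSm := measurable_expMul (γ := γ) hw
    refine eLpNorm_two_average_le hρc hρ0 hρi hρ1 ?_ fun a ha => (hball a (hsupp a ha)).2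
    have h1 : Measurable fun z : ℝ × ℝ => expMul γ w (-z.1 + z.2) := hSm.comp (by fun_prop)
    have h2 : Measurable fun z : ℝ × ℝ => expMul γ w z.2 := hSm.comp measurable_snd
    fun_prop

theorem logDiff_memLp_of_sub {β : ℝ} {q : ℝ → ℝ} (hq : Measurable q) {w v : ℝ → ℂ}
    (hv : Measurable v) (hD : MemLp (logDiff β q w) 2 volume)
    (hle : eLpNorm (logDiff β q (w - v)) 2 volume < ⊤) (hw : Measurable w) :
    MemLp (logDiff β q v) 2 volume := by
  have : v = w - (w - v) := by abel
  rw [this, logDiff_sub]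
  exact hD.sub ⟨(measurable_logDiff hq (hw.sub hv)).aestronglyMeasurable, hle⟩

theorem expMul_memLp_of_sub {γ : ℝ} {w v : ℝ → ℂ} (hv : Measurable v)
    (hS : MemLp (expMul γ w) 2 volume) (hle : eLpNorm (expMul γ (w - v)) 2 volume < ⊤)
    (hw : Measurable w) : MemLp (expMul γ v) 2 volume := by
  have : v = w - (w - v) := by abel
  rw [this, expMul_sub]
  exact hS.sub ⟨(measurable_expMul (hw.sub hv)).aestronglyMeasurable, hle⟩

/-! ### Density in logarithmic coordinates. -/

theorem exists_smooth_logNorm_lt {β γ : ℝ} (hβ : 0 ≤ β) (hγ : β ≤ γ) {q : ℝ → ℝ}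
    (hq : Measurable q) (hq0 : ∀ t, 0 ≤ q t) (hqe : ∀ t, q (-t) = q t)
    (hmom : profileMoment β q < ⊤) {w : ℝ → ℂ} (hw : Measurable w)
    (hD : MemLp (logDiff β q w) 2 volume) (hS : MemLp (expMul γ w) 2 volume)
    {ε : ENNReal} (hε : 0 < ε) :
    ∃ ψ : ℝ → ℂ, ContDiff ℝ ((⊤ : ℕ∞) : WithTop ℕ∞) ψ ∧ HasCompactSupport ψ ∧
      logNorm β γ q (w - ψ) < ε := by
  -- An intermediate δ is finite even when ε = ⊤, and leaves room for three non-strict bounds by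
  -- δ/3.
  obtain ⟨δ, hδ0, hδ⟩ := exists_between hε
  have hδ3 : 0 < δ / 3 := ENNReal.div_pos hδ0.ne' (by norm_num)
  have hδt : δ / 3 < ⊤ := ENNReal.div_lt_top hδ.ne_top (by norm_num)
  have hsub : ∀ w v : ℝ → ℂ, Measurable w → Measurable v → MemLp (logDiff β q w) 2 volume →
      MemLp (expMul γ w) 2 volume → logNorm β γ q (w - v) ≤ δ / 3 →
      MemLp (logDiff β q v) 2 volume ∧ MemLp (expMul γ v) 2 volume := by
    intro w v hw hv hD hS h
    have h' := h.trans_lt hδt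
    exact ⟨logDiff_memLp_of_sub hq hv hD (le_self_add.trans_lt h') hw,
      expMul_memLp_of_sub hv hS (le_add_self.trans_lt h') hw⟩
  obtain ⟨n, hn⟩ := ((tendsto_logNorm_sub_clampC hq hq0 hw hD hS).eventually
    (ge_mem_nhds hδ3)).exists
  set w₁ : ℝ → ℂ := fun x => clampC n (w x) with hw₁
  have hm₁ : Measurable w₁ := (continuous_clampC n).measurable.comp hw
  obtain ⟨hD₁, hS₁⟩ := hsub w w₁ hw hm₁ hD hS hn
  have hM₁ : ∀ x, ‖w₁ x‖ ≤ 2 * n := fun x => norm_clampC_le n _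
  obtain ⟨m, hm⟩ := ((tendsto_logNorm_sub_cutoff hβ hγ hq hq0 hqe hmom hm₁ hM₁ hD₁ hS₁).eventually
    (ge_mem_nhds hδ3)).exists
  set w₂ : ℝ → ℂ := fun x => cutoff m x • w₁ x with hw₂
  have hm₂ : Measurable w₂ := (continuous_cutoff m).measurable.smul hm₁
  obtain ⟨hD₂, hS₂⟩ := hsub w₁ w₂ hm₁ hm₂ hD₁ hS₁ hm
  have hM₂ : ∀ x, ‖w₂ x‖ ≤ 2 * n := fun x => by
    rw [hw₂, norm_smul, Real.norm_eq_abs, abs_of_nonneg (cutoff_nonneg m x)]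
    exact (mul_le_of_le_one_left (norm_nonneg _) (cutoff_le_one m x)).trans (hM₁ x)
  have hc₂ : HasCompactSupport w₂ := by
    refine HasCompactSupport.intro (isCompact_Icc (a := -(2 * (m + 1 : ℝ))) (b := 2 * (m + 1)))
      fun x hx => ?_
    have : 2 * (m + 1 : ℝ) ≤ |x| := by
      by_contra h
      exact hx (mem_Icc.2 (abs_le.1 (not_le.1 h).le))
    rw [hw₂]
    simp only [cutoff_eq_zero this, zero_smul]
  obtain ⟨ψ, hψ, hψc, hψle⟩ := exists_smooth_logNorm_sub_lt (β := β) (γ := γ) hq hm₂ hM₂ hc₂ hD₂ hS₂ hδ3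
  have hψm : Measurable ψ := hψ.continuous.measurable
  refine ⟨ψ, hψ, hψc, lt_of_le_of_lt ?_ hδ⟩
  have hψle' : logNorm β γ q (w₂ - ψ) ≤ δ / 3 := by
    refine le_trans (le_of_eq ?_) hψle
    rw [logNorm, logNorm, logDiff_sub, logDiff_sub, expMul_sub, expMul_sub, eLpNorm_sub_comm,
      eLpNorm_sub_comm (expMul γ w₂)]
  calc logNorm β γ q (w - ψ)
      ≤ logNorm β γ q (w - w₁) + (logNorm β γ q (w₁ - w₂) + logNorm β γ q (w₂ - ψ)) :=
        (logNorm_add_sub_le hq hw hm₁ hψm).trans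
          (add_le_add le_rfl (logNorm_add_sub_le hq hm₁ hm₂ hψm))
    _ ≤ δ / 3 + (δ / 3 + δ / 3) := add_le_add hn (add_le_add hm hψle')
    _ = δ := by rw [← add_assoc, ENNReal.add_thirds]

/-! ### The hypergeometric function near z = 1. -/

/-- The coefficient ratio is (n+a)(n+b)/((n+c)(n+1)) = 1 + (a+b-c-1)/n + O(n⁻²), eventually below
the growth ratio of (n+1)^θ. The quotient by (n+1)^θ is therefore eventually nonincreasing. -/
theorem exists_hypergeometricCoefficient_le {a b c θ : ℝ} (ha : 0 < a) (hb : 0 < b) (hc : 0 < c)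
    (hθ0 : 0 ≤ θ) (hθ1 : θ ≤ 1) (hθ : a + b - c - 1 < θ) :
    ∃ C, 0 ≤ C ∧ ∀ n : ℕ, 0 ≤ ordinaryHypergeometricCoefficient a b c n ∧
      ordinaryHypergeometricCoefficient a b c n ≤ C * (n + 1 : ℝ) ^ θ := by
  set A : ℕ → ℝ := ordinaryHypergeometricCoefficient a b c with hA
  have hpos : ∀ n, 0 < A n := fun n => by
    have h1 := ascPochhammer_pos n a ha
    have h2 := ascPochhammer_pos n b hb
    have h3 := ascPochhammer_pos n c hc
    simp only [hA, ordinaryHypergeometricCoefficient]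
    positivity
  have hrec : ∀ n : ℕ, A (n + 1) * ((n + c) * (n + 1)) = A n * ((n + a) * (n + b)) := fun n => by
    have h3 := ascPochhammer_pos n c hc
    have h4 : (0 : ℝ) < c + n := by positivity
    simp only [hA, ordinaryHypergeometricCoefficient, ascPochhammer_succ_eval, Nat.factorial_succ]
    push_cast
    field_simp
    ring
  obtain ⟨N, hN⟩ : ∃ N : ℕ, ∀ n : ℕ, N ≤ n →
      (n + a) * (n + b) * (n + 2 - θ) ≤ (n + c) * (n + 1) * (n + 2 : ℝ) := by
    -- This is the n² coefficient of the difference of the two cubics, whose n³ terms cancel; N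
    -- makes d n² dominate the lower-order terms.
    set d := θ - (a + b - c - 1) with hd
    have hd0 : 0 < d := by simp only [hd]; linarith
    obtain ⟨N, hN⟩ := exists_nat_ge (max 1 ((|a * b + (a + b) * (2 - θ)| + |a * b * (2 - θ)|) / d))
    refine ⟨N, fun n hn => ?_⟩
    have hn' : (N : ℝ) ≤ n := by exact_mod_cast hn
    have hn1 : (1 : ℝ) ≤ n := (le_max_left _ _).trans (hN.trans hn')
    have h2 := (le_max_right _ _).trans (hN.trans hn')
    rw [div_le_iff₀ hd0] at h2
    have h3 := le_abs_self (a * b + (a + b) * (2 - θ))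
    have h4 := le_abs_self (a * b * (2 - θ))
    have h5 : |a * b * (2 - θ)| ≤ |a * b * (2 - θ)| * n :=
      le_mul_of_one_le_right (abs_nonneg _) hn1
    have h6 : (a * b + (a + b) * (2 - θ)) * n ≤ |a * b + (a + b) * (2 - θ)| * n := by gcongr
    have h7 : (|a * b + (a + b) * (2 - θ)| + |a * b * (2 - θ)|) * n ≤ n * d * n := by gcongr
    have h8 : (0 : ℝ) ≤ 3 * c * n := by positivity
    simp only [hd] at h7
    nlinarith
  have hstep : ∀ n : ℕ, N ≤ n → A (n + 1) / ((n + 1 : ℕ) + 1 : ℝ) ^ θ ≤ A n / (n + 1 : ℝ) ^ θ := by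
    intro n hn
    have e : ((n + 1 : ℕ) + 1 : ℝ) = n + 2 := by push_cast; ring
    rw [e, div_le_div_iff₀ (by positivity) (by positivity)]
    -- Bernoulli's inequality for an exponent in [0,1], applied to (n+1)/(n+2) = 1 - 1/(n+2).
    have hr : (n + 1 : ℝ) ^ θ ≤ (n + 2 - θ) / (n + 2) * (n + 2 : ℝ) ^ θ := by
      have h1 : (n + 1 : ℝ) = (1 + -(1 / (n + 2))) * (n + 2) := by field_simp; ring
      have h2 : (-1 : ℝ) ≤ -(1 / (n + 2)) := by
        rw [neg_le_neg_iff, div_le_one (by positivity)]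
        linarith [(n.cast_nonneg : (0 : ℝ) ≤ n)]
      have h3 := rpow_one_add_le_one_add_mul_self h2 hθ0 hθ1
      conv_lhs => rw [h1]
      rw [Real.mul_rpow (by linarith) (by positivity)]
      refine mul_le_mul_of_nonneg_right (h3.trans (le_of_eq ?_)) (by positivity)
      field_simp
      ring
    have hk : A (n + 1) * (n + 2 - θ) ≤ A n * (n + 2) := by
      have hp : (0 : ℝ) < (n + c) * (n + 1) := by positivity
      refine le_of_mul_le_mul_right ?_ hp
      calc A (n + 1) * (n + 2 - θ) * ((n + c) * (n + 1))
          = A (n + 1) * ((n + c) * (n + 1)) * (n + 2 - θ) := by ring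
        _ = A n * ((n + a) * (n + b) * (n + 2 - θ)) := by rw [hrec]; ring
        _ ≤ A n * ((n + c) * (n + 1) * (n + 2 : ℝ)) :=
            mul_le_mul_of_nonneg_left (hN n hn) (hpos n).le
        _ = _ := by ring
    calc A (n + 1) * (n + 1 : ℝ) ^ θ ≤ A (n + 1) * ((n + 2 - θ) / (n + 2) * (n + 2 : ℝ) ^ θ) :=
          mul_le_mul_of_nonneg_left hr (hpos _).le
      _ = (A (n + 1) * (n + 2 - θ)) / (n + 2) * (n + 2 : ℝ) ^ θ := by ring
      _ ≤ (A n * (n + 2)) / (n + 2) * (n + 2 : ℝ) ^ θ := by gcongr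
      _ = _ := by rw [mul_div_cancel_right₀ _ (by positivity)]
  set R : ℕ → ℝ := fun n => A n / (n + 1 : ℝ) ^ θ with hR
  have hR0 : ∀ n, 0 ≤ R n := fun n => div_nonneg (hpos n).le (by positivity)
  have htail : ∀ n, N ≤ n → R n ≤ R N := fun n hn => by
    induction n, hn using Nat.le_induction with
    | base => exact le_rfl
    | succ n hn ih => exact (hstep n hn).trans ih
  refine ⟨∑ n ∈ Finset.range (N + 1), R n, Finset.sum_nonneg fun n _ => hR0 n,
    fun n => ⟨(hpos n).le, ?_⟩⟩
  have hle : R n ≤ ∑ n ∈ Finset.range (N + 1), R n := by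
    rcases le_total N n with h | h
    · exact (htail n h).trans (Finset.single_le_sum (fun i _ => hR0 i)
        (Finset.mem_range.2 (Nat.lt_succ_self N)))
    · exact Finset.single_le_sum (fun i _ => hR0 i) (Finset.mem_range.2 (Nat.lt_succ_of_le h))
  rwa [hR, div_le_iff₀ (by positivity)] at hle

/-- Since y^θ ≤ 1 + y at y = (n+1)(1-z), the series is majorized by a combination of ∑ z^n and ∑
(n+1) z^n. -/
theorem summable_add_one_rpow_mul_pow_and_tsum_le {θ z : ℝ} (hθ0 : 0 ≤ θ) (hθ1 : θ ≤ 1)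
    (hz0 : 0 ≤ z) (hz1 : z < 1) :
    Summable (fun n : ℕ => (n + 1 : ℝ) ^ θ * z ^ n) ∧
      ∑' n : ℕ, (n + 1 : ℝ) ^ θ * z ^ n ≤ 2 * (1 - z) ^ (-(1 + θ)) := by
  have hz : 0 < 1 - z := by linarith
  have hn : ‖z‖ < 1 := by rwa [Real.norm_eq_abs, abs_of_nonneg hz0]
  have h1 : HasSum (fun n : ℕ => z ^ n) (1 - z)⁻¹ := hasSum_geometric_of_lt_one hz0 hz1
  have h2 : HasSum (fun n : ℕ => (n + 1 : ℝ) * z ^ n) (1 / (1 - z) ^ 2) := by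
    have := hasSum_choose_mul_geometric_of_norm_lt_one 1 hn
    simpa using this
  have h3 : HasSum (fun n : ℕ => (1 - z) ^ (-θ) * (z ^ n + (1 - z) * ((n + 1 : ℝ) * z ^ n)))
      (2 * (1 - z) ^ (-(1 + θ))) := by
    have := (h1.add (h2.mul_left (1 - z))).mul_left ((1 - z) ^ (-θ))
    have e : 2 * (1 - z) ^ (-(1 + θ))
        = (1 - z) ^ (-θ) * ((1 - z)⁻¹ + (1 - z) * (1 / (1 - z) ^ 2)) := by
      rw [neg_add, Real.rpow_add hz, Real.rpow_neg_one]
      field_simp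
      ring
    rwa [e]
  have hle : ∀ n : ℕ, (n + 1 : ℝ) ^ θ * z ^ n
      ≤ (1 - z) ^ (-θ) * (z ^ n + (1 - z) * ((n + 1 : ℝ) * z ^ n)) := fun n => by
    set y : ℝ := (n + 1) * (1 - z) with hy
    have hy0 : 0 ≤ y := by positivity
    have hyθ : y ^ θ ≤ 1 + y := by
      rcases le_total y 1 with h | h
      · exact (Real.rpow_le_one hy0 h hθ0).trans (by linarith)
      · refine (Real.rpow_le_rpow_of_exponent_le h hθ1).trans ?_
        rw [Real.rpow_one]; linarith
    have e : (n + 1 : ℝ) ^ θ = (1 - z) ^ (-θ) * y ^ θ := by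
      rw [hy, Real.mul_rpow (by positivity) hz.le, Real.rpow_neg hz.le]
      field_simp
    rw [e, mul_assoc]
    refine mul_le_mul_of_nonneg_left ?_ (by positivity)
    calc y ^ θ * z ^ n ≤ (1 + y) * z ^ n := by gcongr
      _ = _ := by rw [hy]; ring
  have hs := h3.summable.of_nonneg_of_le (fun n => by positivity) hle
  exact ⟨hs, (hs.tsum_le_tsum hle h3.summable).trans_eq h3.tsum_eq⟩

theorem exists_ordinaryHypergeometric_le {a b c θ : ℝ} (ha : 0 < a) (hb : 0 < b) (hc : 0 < c)
    (hθ0 : 0 ≤ θ) (hθ1 : θ ≤ 1) (hθ : a + b - c - 1 < θ) :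
    ∃ C, 0 ≤ C ∧ ∀ z : ℝ, 0 ≤ z → z < 1 →
      0 ≤ ordinaryHypergeometric a b c z ∧
      ordinaryHypergeometric a b c z ≤ C * (1 - z) ^ (-(1 + θ)) := by
  obtain ⟨C, hC0, hC⟩ := exists_hypergeometricCoefficient_le ha hb hc hθ0 hθ1 hθ
  refine ⟨C * 2, by positivity, fun z hz0 hz1 => ?_⟩
  obtain ⟨hs, hle⟩ := summable_add_one_rpow_mul_pow_and_tsum_le hθ0 hθ1 hz0 hz1
  have e : ordinaryHypergeometric a b c z
      = ∑' n, ordinaryHypergeometricCoefficient a b c n * z ^ n := by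
    rw [ordinaryHypergeometric_eq_tsum]; rfl
  rw [e]
  have hb1 : ∀ n : ℕ, ordinaryHypergeometricCoefficient a b c n * z ^ n
      ≤ C * ((n + 1 : ℝ) ^ θ * z ^ n) := fun n => by
    rw [← mul_assoc]
    exact mul_le_mul_of_nonneg_right (hC n).2 (by positivity)
  have hb0 : ∀ n : ℕ, 0 ≤ ordinaryHypergeometricCoefficient a b c n * z ^ n := fun n =>
    mul_nonneg (hC n).1 (by positivity)
  refine ⟨tsum_nonneg hb0, ?_⟩
  refine ((hs.mul_left C).of_nonneg_of_le hb0 hb1 |>.tsum_le_tsum hb1 (hs.mul_left C)).trans ?_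
  rw [tsum_mul_left, mul_assoc]
  gcongr

theorem continuousOn_ordinaryHypergeometric {a b c : ℝ} (ha : 0 < a) (hb : 0 < b) (hc : 0 < c) :
    ContinuousOn (ordinaryHypergeometric a b c : ℝ → ℝ) (Metric.ball 0 1) := by
  have hr : (ordinaryHypergeometricSeries ℝ a b c).radius = 1 :=
    ordinaryHypergeometricSeries_radius_eq_one ℝ a b c fun n => by
      have : (0 : ℝ) ≤ n := n.cast_nonneg
      refine ⟨?_, ?_, ?_⟩ <;> intro h <;> linarith
  have h := ((ordinaryHypergeometricSeries ℝ a b c).hasFPowerSeriesOnBall (by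
    rw [hr]; exact one_pos)).continuousOn
  rw [hr] at h
  refine h.mono fun x hx => ?_
  rw [Metric.mem_eball, edist_dist]
  exact ENNReal.ofReal_lt_one.2 hx

/-! ### The kernel profile and its moment. -/

/-- The Lévy kernel in logarithmic coordinates, stripped of its exponential growth. -/
def levyProfile (ζ α t : ℝ) : ℝ :=
  2 ^ (1 + α) * (Real.Gamma (α / 2 + 1) * Real.sin (Real.pi * α / 2) / Real.pi)
    * Real.Gamma (ζ + α / 2 + 1 / 2)
    * (2 * Real.cosh t) ^ (-(ζ + α / 2 + 1 / 2))
    * regHypergeometric ((ζ + α / 2 + 1 / 2) / 2) ((ζ + α / 2 + 3 / 2) / 2) (ζ + 1 / 2)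
        (1 / Real.cosh t ^ 2)

theorem levyProfile_neg (ζ α t : ℝ) : levyProfile ζ α (-t) = levyProfile ζ α t := by
  rw [levyProfile, levyProfile, Real.cosh_neg]

/-- Everything follows from e^{2x} + e^{2y} = 2 e^{x+y} cosh(x-y). -/
theorem levyKernel_exp (ζ α x y : ℝ) :
    levyKernel ζ α (Real.exp x) (Real.exp y)
      = Real.exp (-(x + y) * (ζ + α / 2 + 1 / 2)) * levyProfile ζ α (x - y) := by
  have e1 : Real.exp x ^ 2 + Real.exp y ^ 2 = Real.exp (x + y) * (2 * Real.cosh (x - y)) := by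
    rw [Real.cosh_eq, mul_div_cancel₀ _ two_ne_zero, mul_add, ← Real.exp_add, ← Real.exp_add,
      ← Real.exp_nat_mul, ← Real.exp_nat_mul]
    push_cast
    ring_nf
  have hc : 0 < Real.cosh (x - y) := Real.cosh_pos _
  have e2 : 4 * (Real.exp x * Real.exp y) ^ 2 / (Real.exp x ^ 2 + Real.exp y ^ 2) ^ 2
      = 1 / Real.cosh (x - y) ^ 2 := by
    rw [e1, ← Real.exp_add]
    field_simp
    ring
  have e3 : (Real.exp x ^ 2 + Real.exp y ^ 2) ^ (-(ζ + α / 2 + 1 / 2))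
      = Real.exp (-(x + y) * (ζ + α / 2 + 1 / 2))
        * (2 * Real.cosh (x - y)) ^ (-(ζ + α / 2 + 1 / 2)) := by
    rw [e1, Real.mul_rpow (Real.exp_pos _).le (by positivity), ← Real.exp_mul]
    ring_nf
  rw [levyKernel, levyProfile, e2, e3]
  ring

theorem one_div_cosh_sq_mem {t : ℝ} (ht : t ≠ 0) :
    0 ≤ 1 / Real.cosh t ^ 2 ∧ 1 / Real.cosh t ^ 2 < 1 := by
  have h := Real.one_lt_cosh.2 ht
  exact ⟨by positivity, by rw [div_lt_one (by positivity)]; nlinarith⟩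

theorem measurable_levyProfile {ζ α : ℝ} (hζ : -1 / 2 < ζ) (hα : 0 < α) :
    Measurable (levyProfile ζ α) := by
  refine measurable_of_continuousOn_compl_singleton 0 ?_
  have hF := continuousOn_ordinaryHypergeometric (a := (ζ + α / 2 + 1 / 2) / 2)
    (b := (ζ + α / 2 + 3 / 2) / 2) (c := ζ + 1 / 2) (by linarith) (by linarith) (by linarith)
  have hz : ContinuousOn (fun t : ℝ => 1 / Real.cosh t ^ 2) {0}ᶜ :=
    (continuous_const.div (Real.continuous_cosh.pow 2)
      fun t => (pow_pos (Real.cosh_pos t) 2).ne').continuousOn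
  have hc := hF.comp hz fun t ht => by
    have := one_div_cosh_sq_mem ht
    rw [mem_ball_zero_iff, Real.norm_eq_abs, abs_of_nonneg this.1]
    exact this.2
  have hp : Continuous fun t : ℝ => (2 * Real.cosh t) ^ (-(ζ + α / 2 + 1 / 2)) :=
    (continuous_const.mul Real.continuous_cosh).rpow_const fun t =>
      Or.inl (mul_pos two_pos (Real.cosh_pos t)).ne'
  exact (continuousOn_const.mul hp.continuousOn).mul (hc.div_const _)

/-- The right side is tanh² t, and tanh t ≥ t/(1+t) because sinh t ≥ t and cosh t ≤ 1 + sinh t. -/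
theorem div_one_add_sq_le {t : ℝ} (ht : 0 < t) :
    (t / (1 + t)) ^ 2 ≤ 1 - 1 / Real.cosh t ^ 2 := by
  have hs : t ≤ Real.sinh t := Real.self_le_sinh_iff.2 ht.le
  have hc : 0 < Real.cosh t := Real.cosh_pos t
  have h1 : Real.cosh t - Real.sinh t ≤ 1 := by
    rw [Real.cosh_sub_sinh]
    exact Real.exp_le_one_iff.2 (by linarith)
  have e : 1 - 1 / Real.cosh t ^ 2 = (Real.sinh t / Real.cosh t) ^ 2 := by
    rw [div_pow, Real.sinh_sq]
    field_simp
  rw [e]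
  refine pow_le_pow_left₀ (by positivity) ?_ 2
  rw [div_le_div_iff₀ (by positivity) hc]
  nlinarith

theorem exists_levyProfile_le {ζ α : ℝ} (hζ : -1 / 2 < ζ) (hα₀ : 0 < α) (hα : α < 2) :
    ∃ C, 0 ≤ C ∧ ∀ t, 0 < t → levyProfile ζ α t
      ≤ C * (Real.exp (-(ζ + α / 2 + 1 / 2) * t) * (t ^ (-(2 + α / 2)) * (1 + t) ^ 3)) := by
  -- Here a+b-c-1 = (α-1)/2, so θ = α/4 is admissible exactly when α < 2. The resulting singularity
  -- t^{-2-α/2} is cruder than the true t^{-1-α}, but still integrable against t².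
  obtain ⟨C, hC0, hC⟩ := exists_ordinaryHypergeometric_le (a := (ζ + α / 2 + 1 / 2) / 2)
    (b := (ζ + α / 2 + 3 / 2) / 2) (c := ζ + 1 / 2) (θ := α / 4) (by linarith) (by linarith)
    (by linarith) (by linarith) (by linarith) (by linarith)
  set K := 2 ^ (1 + α) * (Real.Gamma (α / 2 + 1) * Real.sin (Real.pi * α / 2) / Real.pi)
    * Real.Gamma (ζ + α / 2 + 1 / 2) with hK
  have hG : 0 < Real.Gamma (ζ + 1 / 2) := Real.Gamma_pos_of_pos (by linarith)
  refine ⟨|K| * (C / Real.Gamma (ζ + 1 / 2)), by positivity, fun t ht => ?_⟩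
  obtain ⟨hz0, hz1⟩ := one_div_cosh_sq_mem ht.ne'
  obtain ⟨hF0, hF⟩ := hC _ hz0 hz1
  set p := ζ + α / 2 + 1 / 2 with hp
  have hp0 : 0 < p := by rw [hp]; linarith
  have hcosh : (2 * Real.cosh t) ^ (-p) ≤ Real.exp (-p * t) := by
    have : Real.exp t ≤ 2 * Real.cosh t := by
      rw [Real.cosh_eq]; linarith [Real.exp_pos (-t)]
    calc (2 * Real.cosh t) ^ (-p) ≤ Real.exp t ^ (-p) :=
          Real.rpow_le_rpow_of_nonpos (Real.exp_pos t) this (by linarith)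
      _ = _ := by rw [← Real.exp_mul, mul_comm]
  have hpow : (1 - 1 / Real.cosh t ^ 2) ^ (-(1 + α / 4)) ≤ t ^ (-(2 + α / 2)) * (1 + t) ^ 3 := by
    calc (1 - 1 / Real.cosh t ^ 2) ^ (-(1 + α / 4))
        ≤ ((t / (1 + t)) ^ 2) ^ (-(1 + α / 4)) :=
          Real.rpow_le_rpow_of_nonpos (by positivity) (div_one_add_sq_le ht) (by linarith)
      _ = (t / (1 + t)) ^ (-(2 + α / 2)) := by
          rw [← Real.rpow_natCast, ← Real.rpow_mul (by positivity)]
          congr 1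
          push_cast
          ring
      _ = t ^ (-(2 + α / 2)) * (1 + t) ^ (2 + α / 2) := by
          rw [Real.div_rpow ht.le (by linarith), Real.rpow_neg (by linarith : (0:ℝ) ≤ 1 + t),
            div_inv_eq_mul]
      _ ≤ _ := by
          rw [← Real.rpow_natCast (1 + t)]
          refine mul_le_mul_of_nonneg_left ?_ (by positivity)
          exact Real.rpow_le_rpow_of_exponent_le (by linarith) (by push_cast; linarith)
  have e : levyProfile ζ α t = K * ((2 * Real.cosh t) ^ (-p) *
      (ordinaryHypergeometric (p / 2) ((ζ + α / 2 + 3 / 2) / 2) (ζ + 1 / 2) (1 / Real.cosh t ^ 2)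
        / Real.Gamma (ζ + 1 / 2))) := by
    rw [levyProfile, regHypergeometric, ← hK, mul_assoc]
  rw [e, mul_assoc |K|]
  have hcp := Real.cosh_pos t
  calc _ ≤ |K| * _ := mul_le_mul_of_nonneg_right (le_abs_self K) (by positivity)
    _ ≤ _ := by
      refine mul_le_mul_of_nonneg_left ?_ (abs_nonneg K)
      calc _ ≤ Real.exp (-p * t) * (C * (t ^ (-(2 + α / 2)) * (1 + t) ^ 3)
            / Real.Gamma (ζ + 1 / 2)) := by
            refine mul_le_mul hcosh ?_ (by positivity) (Real.exp_pos _).le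
            refine div_le_div_of_nonneg_right (hF.trans ?_) hG.le
            exact mul_le_mul_of_nonneg_left hpow hC0
        _ = _ := by ring

/-- Near 0 the integrand is O(t^{-α/2}) with α/2 < 1; at infinity the hypothesis on β leaves a decay
e^{-αt} against a power of t. -/
theorem profileMoment_levyProfile_lt_top {ζ α β : ℝ} (hζ : -1 / 2 < ζ) (hα₀ : 0 < α) (hα : α < 2)
    (hβ : β + α ≤ ζ + α / 2 + 1 / 2) :
    profileMoment β (fun t => √(levyProfile ζ α t)) < ⊤ := by
  obtain ⟨C, hC0, hC⟩ := exists_levyProfile_le hζ hα₀ hα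
  set G : ℝ → ℝ := fun t => 4 * C * (t ^ (-(α / 2)) * Real.exp (-α * t ^ (1 : ℝ))
    + t ^ (3 - α / 2) * Real.exp (-α * t ^ (1 : ℝ))) with hG
  have hGi : IntegrableOn G (Ioi 0) :=
    ((integrableOn_rpow_mul_exp_neg_mul_rpow (by linarith) one_pos hα₀).add
      (integrableOn_rpow_mul_exp_neg_mul_rpow (by linarith) one_pos hα₀)).const_mul _
  have hGm : Measurable G := by
    simp only [hG]
    fun_prop
  set I : ℝ → ENNReal := (Ioi (0 : ℝ)).indicator fun t => ENNReal.ofReal (G t) with hI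
  have hIm : Measurable I := hGm.ennreal_ofReal.indicator measurableSet_Ioi
  have hIfin : ∫⁻ t, I t < ⊤ := by
    rw [hI, lintegral_indicator measurableSet_Ioi]
    exact hGi.lintegral_lt_top
  set f : ℝ → ENNReal := fun t =>
    ENNReal.ofReal (√(levyProfile ζ α t) ^ 2 * Real.exp (β * |t|) * t ^ 2) with hf
  have hpos : ∀ t, 0 < t → f t ≤ I t := by
    intro t ht
    rw [hI, indicator_of_mem (mem_Ioi.2 ht)]
    refine ENNReal.ofReal_le_ofReal ?_
    set B := C * (Real.exp (-(ζ + α / 2 + 1 / 2) * t) * (t ^ (-(2 + α / 2)) * (1 + t) ^ 3)) with hB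
    have hB0 : 0 ≤ B := by positivity
    have h1 : √(levyProfile ζ α t) ^ 2 ≤ B := by
      rw [← Real.sq_sqrt hB0]
      exact pow_le_pow_left₀ (Real.sqrt_nonneg _) (Real.sqrt_le_sqrt (hC t ht)) 2
    have h2 : Real.exp (-(ζ + α / 2 + 1 / 2) * t) * Real.exp (β * t) ≤ Real.exp (-α * t) := by
      rw [← Real.exp_add]
      refine Real.exp_le_exp.2 ?_
      have := mul_le_mul_of_nonneg_right hβ ht.le
      linarith
    have h3 : t ^ (-(2 + α / 2)) * t ^ 2 = t ^ (-(α / 2)) := by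
      rw [← Real.rpow_natCast, ← Real.rpow_add ht]
      congr 1
      push_cast
      ring
    have h4 : (1 + t) ^ 3 ≤ 4 * (1 + t ^ 3) := by nlinarith [mul_nonneg (by linarith : 0 ≤ 1 + t) (sq_nonneg (1 - t))]
    have h5 : t ^ (-(α / 2)) * t ^ 3 = t ^ (3 - α / 2) := by
      rw [← Real.rpow_natCast t 3, ← Real.rpow_add ht]
      congr 1
      push_cast
      ring
    rw [abs_of_pos ht]
    calc √(levyProfile ζ α t) ^ 2 * Real.exp (β * t) * t ^ 2
        ≤ B * Real.exp (β * t) * t ^ 2 := by gcongr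
      _ = C * ((Real.exp (-(ζ + α / 2 + 1 / 2) * t) * Real.exp (β * t))
            * ((t ^ (-(2 + α / 2)) * t ^ 2) * (1 + t) ^ 3)) := by rw [hB]; ring
      _ ≤ C * (Real.exp (-α * t) * (t ^ (-(α / 2)) * (4 * (1 + t ^ 3)))) := by
          rw [h3]; gcongr
      _ = G t := by
          simp only [hG, Real.rpow_one, ← h5]
          ring
  have hneg : ∀ t, f (-t) = f t := fun t => by simp only [hf, levyProfile_neg, abs_neg, neg_sq]
  -- Evenness reduces to t > 0; at t = 0 the factor t² kills the integrand.
  calc ∫⁻ t, f t ≤ ∫⁻ t, (I t + I (-t)) := by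
        refine lintegral_mono fun t => ?_
        rcases lt_trichotomy t 0 with h | h | h
        · rw [← hneg t]
          exact (hpos (-t) (by linarith)).trans le_add_self
        · simp [hf, h]
        · exact (hpos t h).trans le_self_add
    _ = (∫⁻ t, I t) + ∫⁻ t, I t := by
        rw [lintegral_add_left hIm, lintegral_neg_eq_self]
    _ < ⊤ := ENNReal.add_lt_top.2 ⟨hIfin, hIfin⟩

/-! ### Change of variables between the half-line and the line. -/

/-- The quotient `u / h` in logarithmic coordinates. -/
def logCoord (η : ℝ) (u : ℝ → ℂ) (x : ℝ) : ℂ :=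
  u (Real.exp x) / (groundState η (Real.exp x) : ℂ)

theorem groundState_exp (η x : ℝ) : groundState η (Real.exp x) = Real.exp (-η * x) := by
  rw [groundState, ← Real.exp_mul, mul_comm]

theorem logCoord_sub (η : ℝ) (u v : ℝ → ℂ) :
    logCoord η (u - v) = logCoord η u - logCoord η v := by
  ext x
  simp only [logCoord, Pi.sub_apply, sub_div]

theorem measurable_logCoord (η : ℝ) {u : ℝ → ℂ} (hu : Measurable u) :
    Measurable (logCoord η u) := by
  have h : Measurable fun x => u (Real.exp x) := hu.comp Real.measurable_exp
  have h' : Measurable fun x => (Real.exp (-η * x) : ℂ) := by fun_prop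
  unfold logCoord
  simp only [groundState_exp]
  exact h.div h'

theorem lintegral_Ioi_eq_lintegral_exp (f : ℝ → ENNReal) :
    ∫⁻ r in Ioi (0 : ℝ), f r = ∫⁻ x, ENNReal.ofReal (Real.exp x) * f (Real.exp x) := by
  have h := lintegral_image_eq_lintegral_abs_deriv_mul (s := univ) (f := Real.exp)
    (f' := Real.exp) MeasurableSet.univ (fun x _ => (Real.hasDerivAt_exp x).hasDerivWithinAt)
    Real.exp_injective.injOn f
  simpa [image_univ, Real.range_exp, abs_of_pos (Real.exp_pos _)] using h

theorem groundForm_eq (ζ α η : ℝ) (u : ℝ → ℂ) :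
    groundForm ζ α η u = (1 / 2) * ∫⁻ x, ∫⁻ y,
      ‖logDiff ((2 * ζ + 1 - α - 2 * η) / 2) (fun t => √(levyProfile ζ α t))
        (logCoord η u) (x, y)‖ₑ ^ 2 := by
  rw [groundForm, lintegral_Ioi_eq_lintegral_exp]
  congr 1
  refine lintegral_congr fun x => ?_
  rw [lintegral_Ioi_eq_lintegral_exp, ← lintegral_const_mul' _ _ ENNReal.ofReal_ne_top]
  refine lintegral_congr fun y => ?_
  rw [← ofReal_norm, ← ENNReal.ofReal_pow (norm_nonneg _),
    norm_logDiff (fun t => Real.sqrt_nonneg _), ← ENNReal.ofReal_mul (Real.exp_pos _).le,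
    ← ENNReal.ofReal_mul (Real.exp_pos _).le, diffWeight]
  simp only [logCoord]
  set N := ‖u (Real.exp x) / (groundState η (Real.exp x) : ℂ)
    - u (Real.exp y) / (groundState η (Real.exp y) : ℂ)‖
  have e1 : Real.exp x * (Real.exp y * (Real.exp x ^ (2 * ζ) * Real.exp y ^ (2 * ζ)
      * levyKernel ζ α (Real.exp x) (Real.exp y) * N ^ 2
      * groundState η (Real.exp x) * groundState η (Real.exp y)))
      = levyProfile ζ α (x - y) *
        (Real.exp ((2 * ζ + 1 - α - 2 * η) / 2 * (x + y) / 2) * N) ^ 2 := by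
    rw [levyKernel_exp, groundState_exp, groundState_exp, ← Real.exp_mul, ← Real.exp_mul, mul_pow,
      ← Real.exp_nat_mul]
    -- Exponent count, per unit of x+y: Jacobian 1, reference weight 2ζ, kernel -(ζ+α/2+1/2), ground
    -- state -η.
    have : ((2 : ℕ) : ℝ) * ((2 * ζ + 1 - α - 2 * η) / 2 * (x + y) / 2)
        = x + y + x * (2 * ζ) + y * (2 * ζ) + -(x + y) * (ζ + α / 2 + 1 / 2)
          + -η * x + -η * y := by push_cast; ring
    rw [this]
    simp only [Real.exp_add]
    ring
  have e2 : (Real.exp ((2 * ζ + 1 - α - 2 * η) / 2 * (x + y) / 2)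
      * √(levyProfile ζ α (x - y)) * N) ^ 2
      = √(levyProfile ζ α (x - y)) ^ 2 *
        (Real.exp ((2 * ζ + 1 - α - 2 * η) / 2 * (x + y) / 2) * N) ^ 2 := by ring
  rw [e1, e2]
  -- No sign of the profile is required: `ENNReal.ofReal` and the square root both send negative
  -- values to 0.
  rcases le_total 0 (levyProfile ζ α (x - y)) with h | h
  · rw [Real.sq_sqrt h]
  · rw [Real.sqrt_eq_zero_of_nonpos h, ENNReal.ofReal_of_nonpos
      (mul_nonpos_of_nonpos_of_nonneg h (sq_nonneg _))]
    simp

theorem groundForm_eq_eLpNorm (ζ α η : ℝ) (hζ : -1 / 2 < ζ) (hα : 0 < α) {u : ℝ → ℂ}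
    (hu : Measurable u) :
    groundForm ζ α η u = (1 / 2) * eLpNorm (logDiff ((2 * ζ + 1 - α - 2 * η) / 2)
      (fun t => √(levyProfile ζ α t)) (logCoord η u)) 2 volume ^ 2 := by
  have hm := measurable_logDiff (β := (2 * ζ + 1 - α - 2 * η) / 2)
    (measurable_levyProfile hζ hα).sqrt (measurable_logCoord η hu)
  rw [groundForm_eq, eLpNorm_two_sq, Measure.volume_eq_prod,
    lintegral_prod _ (hm.enorm.pow_const 2).aemeasurable]

theorem eLpNorm_refMeasure_eq (ζ η : ℝ) (u : ℝ → ℂ) :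
    eLpNorm u 2 (refMeasure ζ) = eLpNorm (expMul (ζ + 1 / 2 - η) (logCoord η u)) 2 volume := by
  have h : eLpNorm u 2 (refMeasure ζ) ^ 2
      = eLpNorm (expMul (ζ + 1 / 2 - η) (logCoord η u)) 2 volume ^ 2 := by
    rw [eLpNorm_two_sq, eLpNorm_two_sq, refMeasure,
      lintegral_withDensity_eq_lintegral_mul_non_measurable _ (by fun_prop)
        (ae_of_all _ fun _ => ENNReal.ofReal_lt_top), lintegral_Ioi_eq_lintegral_exp]
    refine lintegral_congr fun x => ?_
    rw [Pi.mul_apply, ← ofReal_norm, ← ofReal_norm, norm_expMul, logCoord, norm_div,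
      Complex.norm_real, groundState_exp, Real.norm_eq_abs, abs_of_pos (Real.exp_pos _),
      ← ENNReal.ofReal_pow (norm_nonneg _), ← ENNReal.ofReal_pow (by positivity),
      ← ENNReal.ofReal_mul (by positivity), ← ENNReal.ofReal_mul (by positivity)]
    congr 1
    rw [div_eq_mul_inv ‖u (Real.exp x)‖, ← Real.exp_neg, mul_pow, mul_pow, ← Real.exp_nat_mul, ← Real.exp_nat_mul,
      ← Real.exp_mul]
    have : ((2 : ℕ) : ℝ) * ((ζ + 1 / 2 - η) * x)
        = x + x * (2 * ζ) + -(((2 : ℕ) : ℝ) * -(-η * x)) := by push_cast; ring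
    rw [this, Real.exp_add, Real.exp_add, Real.exp_neg]
    field_simp
  exact (ENNReal.pow_right_strictMono two_ne_zero).injective h

theorem ae_eq_restrict_of_ae_eq_refMeasure {ζ : ℝ} {u v : ℝ → ℂ} (h : u =ᵐ[refMeasure ζ] v) :
    u =ᵐ[volume.restrict (Ioi (0 : ℝ))] v := by
  have h' := (ae_withDensity_iff (p := fun x => u x = v x)
    (f := fun r : ℝ => ENNReal.ofReal (r ^ (2 * ζ))) (by fun_prop)).1 h
  filter_upwards [h', ae_restrict_mem measurableSet_Ioi] with r hr h0
  exact hr (ENNReal.ofReal_pos.2 (Real.rpow_pos_of_pos h0 _)).ne'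

theorem groundForm_congr_ae (ζ α η : ℝ) {u v : ℝ → ℂ} (h : u =ᵐ[refMeasure ζ] v) :
    groundForm ζ α η u = groundForm ζ α η v := by
  have h' := ae_eq_restrict_of_ae_eq_refMeasure h
  rw [groundForm, groundForm]
  congr 1
  refine lintegral_congr_ae ?_
  filter_upwards [h'] with r hr
  refine lintegral_congr_ae ?_
  filter_upwards [h'] with s hs
  rw [hr, hs]

theorem formNorm_congr_ae (ζ α η : ℝ) {u v : ℝ → ℂ} (h : u =ᵐ[refMeasure ζ] v) :
    formNorm ζ α η u = formNorm ζ α η v := by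
  rw [formNorm, formNorm, groundForm_congr_ae ζ α η h, eLpNorm_congr_ae h]

theorem formNorm_le_logNorm (ζ α η : ℝ) (hζ : -1 / 2 < ζ) (hα : 0 < α) {u : ℝ → ℂ}
    (hu : Measurable u) :
    formNorm ζ α η u ≤ logNorm ((2 * ζ + 1 - α - 2 * η) / 2) (ζ + 1 / 2 - η)
      (fun t => √(levyProfile ζ α t)) (logCoord η u) := by
  rw [formNorm, logNorm, groundForm_eq_eLpNorm ζ α η hζ hα hu, eLpNorm_refMeasure_eq ζ η]
  gcongr
  set E := eLpNorm (logDiff ((2 * ζ + 1 - α - 2 * η) / 2)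
      (fun t => √(levyProfile ζ α t)) (logCoord η u)) 2 volume
  calc (1 / 2 * E ^ 2) ^ (1 / 2 : ℝ) ≤ (E ^ 2) ^ (1 / 2 : ℝ) := by
        refine ENNReal.rpow_le_rpow ?_ (by norm_num)
        exact mul_le_of_le_one_left zero_le (by simp)
    _ = E := by
        rw [← ENNReal.rpow_natCast, ← ENNReal.rpow_mul]
        norm_num

/-- The inverse of `logCoord` on functions on the half-line, extended by zero. -/
def ofLogCoord (η : ℝ) (ψ : ℝ → ℂ) (r : ℝ) : ℂ :=
  if 0 < r then (groundState η r : ℂ) * ψ (Real.log r) else 0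

theorem logCoord_ofLogCoord (η : ℝ) (ψ : ℝ → ℂ) : logCoord η (ofLogCoord η ψ) = ψ := by
  ext x
  rw [logCoord, ofLogCoord, if_pos (Real.exp_pos x), groundState_exp, Real.log_exp]
  exact mul_div_cancel_left₀ _ (by exact_mod_cast (Real.exp_pos _).ne')

/-- Support in [-R, R] becomes support in [e^{-R}, e^R], away from 0, so the extension by zero is
smooth at and left of the origin. -/
theorem ofLogCoord_mem_testFunctions (η : ℝ) {ψ : ℝ → ℂ}
    (hψ : ContDiff ℝ ((⊤ : ℕ∞) : WithTop ℕ∞) ψ) (hc : HasCompactSupport ψ) :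
    ofLogCoord η ψ ∈ testFunctions := by
  obtain ⟨R, hR⟩ := hc.isCompact.isBounded.subset_closedBall 0
  have hzero : ∀ r, r ∉ Icc (Real.exp (-R)) (Real.exp R) → ofLogCoord η ψ r = 0 := by
    intro r hr
    rw [ofLogCoord]
    split_ifs with h0
    · rw [image_eq_zero_of_notMem_tsupport (f := ψ), mul_zero]
      intro hmem
      have h1 := hR hmem
      rw [mem_closedBall_zero_iff, Real.norm_eq_abs, abs_le] at h1
      exact hr ⟨(Real.le_log_iff_exp_le h0).1 h1.1, (Real.log_le_iff_le_exp h0).1 h1.2⟩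
    · rfl
  have hts : tsupport (ofLogCoord η ψ) ⊆ Icc (Real.exp (-R)) (Real.exp R) :=
    closure_minimal (fun r hr => by_contra fun h => hr (hzero r h)) isClosed_Icc
  refine ⟨?_, HasCompactSupport.intro isCompact_Icc hzero, fun r hr =>
    (Real.exp_pos _).trans_le (hts hr).1⟩
  rw [contDiff_iff_contDiffAt]
  intro r
  by_cases h0 : 0 < r
  · have h1 : ContDiffAt ℝ ((⊤ : ℕ∞) : WithTop ℕ∞)
        (fun r => (groundState η r : ℂ) * ψ (Real.log r)) r := by
      refine ContDiffAt.mul ?_ (hψ.contDiffAt.comp r (Real.contDiffAt_log.2 h0.ne'))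
      exact Complex.ofRealCLM.contDiff.contDiffAt.comp r
        (Real.contDiffAt_rpow_const_of_ne h0.ne')
    refine h1.congr_of_eventuallyEq ?_
    filter_upwards [lt_mem_nhds h0] with s hs
    rw [ofLogCoord, if_pos hs]
  · have h1 : r < Real.exp (-R) := (not_lt.1 h0).trans_lt (Real.exp_pos _)
    refine (contDiffAt_const (c := (0 : ℂ))).congr_of_eventuallyEq ?_
    filter_upwards [gt_mem_nhds h1] with s hs
    exact hzero s fun h => absurd h.1 (not_le.2 hs)

theorem contDiff_logCoord (η : ℝ) {φ : ℝ → ℂ} (hφ : ContDiff ℝ ((⊤ : ℕ∞) : WithTop ℕ∞) φ) :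
    ContDiff ℝ ((⊤ : ℕ∞) : WithTop ℕ∞) (logCoord η φ) := by
  have e : logCoord η φ = fun x => φ (Real.exp x) * ((Real.exp (η * x) : ℝ) : ℂ) := by
    ext x
    rw [logCoord, groundState_exp, div_eq_mul_inv, ← Complex.ofReal_inv, ← Real.exp_neg, neg_mul,
      neg_neg]
  rw [e]
  refine (hφ.comp Real.contDiff_exp).mul (Complex.ofRealCLM.contDiff.comp ?_)
  exact Real.contDiff_exp.comp (contDiff_const.mul contDiff_id)

theorem hasCompactSupport_logCoord (η : ℝ) {φ : ℝ → ℂ} (hc : HasCompactSupport φ)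
    (hpos : tsupport φ ⊆ Ioi (0 : ℝ)) : HasCompactSupport (logCoord η φ) := by
  have hK : IsCompact (Real.log '' tsupport φ) := hc.isCompact.image_of_continuousOn
    (Real.continuousOn_log.mono fun r hr => (hpos hr).ne')
  refine HasCompactSupport.intro hK fun x hx => ?_
  rw [logCoord, image_eq_zero_of_notMem_tsupport fun h => hx ⟨_, h, Real.log_exp x⟩, zero_div]

/-! ### Inclusion and density on the half-line. -/

theorem testFunctions_subset_formDomain {ζ α η : ℝ} (hζ : -1 / 2 < ζ) (hα₀ : 0 < α) (hα : α < 2)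
    (hη₀ : 0 ≤ η) (hη : η ≤ (2 * ζ + 1 - α) / 2) : testFunctions ⊆ formDomain ζ α η := by
  rintro φ ⟨hφ, hc, hpos⟩
  have hw := contDiff_logCoord η hφ
  have hwc := hasCompactSupport_logCoord η hc hpos
  refine ⟨⟨hφ.continuous.aestronglyMeasurable, ?_⟩, ?_⟩
  · rw [eLpNorm_refMeasure_eq ζ η]
    have hcont : Continuous (expMul (ζ + 1 / 2 - η) (logCoord η φ)) := by
      have := hw.continuous
      unfold expMul
      fun_prop
    have hcs : HasCompactSupport (expMul (ζ + 1 / 2 - η) (logCoord η φ)) :=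
      HasCompactSupport.intro hwc.isCompact fun x hx => by
        rw [expMul, image_eq_zero_of_notMem_tsupport hx, smul_zero]
    exact (hcont.memLp_of_hasCompactSupport hcs).2
  · rw [groundForm_eq_eLpNorm ζ α η hζ hα₀ hφ.continuous.measurable]
    obtain ⟨C, hC⟩ := hw.lipschitzWith_of_hasCompactSupport hwc (by simp)
    have := memLp_logDiff_of_lipschitz (β := (2 * ζ + 1 - α - 2 * η) / 2) (by linarith)
      (measurable_levyProfile hζ hα₀).sqrt (fun t => Real.sqrt_nonneg _)
      (fun t => by rw [levyProfile_neg])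
      (profileMoment_levyProfile_lt_top hζ hα₀ hα (by linarith)) hC hwc
    exact ENNReal.mul_lt_top (by norm_num) (ENNReal.pow_lt_top this.2)

theorem exists_testFunction_formNorm_lt {ζ α η : ℝ} (hζ : -1 / 2 < ζ) (hα₀ : 0 < α) (hα : α < 2)
    (hη₀ : 0 ≤ η) (hη : η ≤ (2 * ζ + 1 - α) / 2) {u : ℝ → ℂ} (hu : u ∈ formDomain ζ α η)
    {ε : ENNReal} (hε : 0 < ε) : ∃ φ ∈ testFunctions, formNorm ζ α η (u - φ) < ε := by
  obtain ⟨huL, huI⟩ := hu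
  -- Form and norm depend only on the almost-everywhere class, so a measurable representative may be
  -- used.
  set v := huL.1.mk u
  have hv : Measurable v := huL.1.stronglyMeasurable_mk.measurable
  have huv : u =ᵐ[refMeasure ζ] v := huL.1.ae_eq_mk
  set β := (2 * ζ + 1 - α - 2 * η) / 2 with hβ
  set q : ℝ → ℝ := fun t => √(levyProfile ζ α t) with hq
  have hqm : Measurable q := (measurable_levyProfile hζ hα₀).sqrt
  have hw := measurable_logCoord η hv
  have hD : MemLp (logDiff β q (logCoord η v)) 2 volume := by
    refine ⟨(measurable_logDiff hqm hw).aestronglyMeasurable, ?_⟩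
    rw [groundForm_congr_ae ζ α η huv, groundForm_eq_eLpNorm ζ α η hζ hα₀ hv] at huI
    by_contra h
    rw [not_lt, top_le_iff] at h
    rw [h] at huI
    simp at huI
  have hS : MemLp (expMul (ζ + 1 / 2 - η) (logCoord η v)) 2 volume := by
    refine ⟨(measurable_expMul hw).aestronglyMeasurable, ?_⟩
    rw [← eLpNorm_refMeasure_eq ζ η, ← eLpNorm_congr_ae huv]
    exact huL.2
  -- The side conditions: β ≥ 0 is the upper bound on η, γ - β = α/2 gives β ≤ γ, and the moment
  -- condition reduces to η ≥ 0.
  obtain ⟨ψ, hψ, hψc, hlt⟩ := exists_smooth_logNorm_lt (β := β) (γ := ζ + 1 / 2 - η)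
    (by linarith) (by linarith) hqm (fun t => Real.sqrt_nonneg _)
    (fun t => by simp only [hq, levyProfile_neg])
    (profileMoment_levyProfile_lt_top hζ hα₀ hα (by linarith)) hw hD hS hε
  have hφ := ofLogCoord_mem_testFunctions η hψ hψc
  refine ⟨ofLogCoord η ψ, hφ, ?_⟩
  rw [formNorm_congr_ae ζ α η (huv.sub (EventuallyEq.refl _ (ofLogCoord η ψ)))]
  refine (formNorm_le_logNorm ζ α η hζ hα₀ (hv.sub hφ.1.continuous.measurable)).trans_lt ?_
  rwa [logCoord_sub, logCoord_ofLogCoord]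

end HardyForm

end

theorem mainTheorem5 (ζ α η : ℝ) (hζ : -1 / 2 < ζ)
    (hα₀ : 0 < α) (hα : α < min 2 (2 * ζ + 1))
    (hη₀ : 0 ≤ η) (hη : η ≤ (2 * ζ + 1 - α) / 2) :
    HardyForm.testFunctions ⊆ HardyForm.formDomain ζ α η ∧
      ∀ u ∈ HardyForm.formDomain ζ α η, ∀ ε : ℝ, 0 < ε →
        ∃ φ ∈ HardyForm.testFunctions,
          HardyForm.formNorm ζ α η (u - φ) < ENNReal.ofReal ε := by
  have hα2 : α < 2 := hα.trans_le (min_le_left _ _)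
  exact ⟨HardyForm.testFunctions_subset_formDomain hζ hα₀ hα2 hη₀ hη, fun u hu ε hε =>
    HardyForm.exists_testFunction_formNorm_lt hζ hα₀ hα2 hη₀ hη hu (ENNReal.ofReal_pos.2 hε)⟩
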